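/- All graphs are finite, simple and connected. A set $D\subseteq V(G)$ is a total dominating set of $G$ if every vertex of $G$ has a neighbour in $D$; $\gamma_t(G)$ is the smallest size of a total dominating set of $G$ (with $\gamma_t(G)=\infty$ if there is none, i.e. if $G$ has a single vertex). For an edge $e=uv$ of $G$, the graph $G/e$ is obtained by removing $u$ and $v$ and adding a new vertex adjacent to exactly those remaining vertices that were adjacent to $u$ or $v$. The problem 1-Edge Contraction($\gamma_t$) asks, for a given connected graph $G$, whether $G$ has an edge $e$ with $\gamma_t(G/e)\le \gamma_t(G)-1$. The problem Total Dominating Set asks, for given $G$ and an integer $k\ge 0$, whether $G$ has a total dominating set of size at most $k$. A graph class is a class of graphs closed under isomorphism; a problem is polynomial-time solvable on a class $\mathcal C$ if a polynomial-time algorithm answers correctly on every instance whose graph lies in $\mathcal C$. For a graph $H$, not necessarily connected, a graph is $H$-free if it has no induced subgraph isomorphic to $H$, and $H+K_1$ is the disjoint union of $H$ with a single vertex. Proposition. Let $\mathcal C$ be a graph class. Then 1-Edge Contraction($\gamma_t$) is polynomial-time solvable on $\mathcal C$ if one of the following holds: (a) $\mathcal C$ is closed under edge contraction and Total Dominating Set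 is polynomial-time solvable on $\mathcal C$; or (b) there is a constant $q$ such that $\gamma_t(G)\le q$ for every $G\in\mathcal C$ with $\gamma_t(G)<\infty$; or (c) there is a fixed finite graph $H$ such that $\mathcal C$ is the class of $(H+K_1)$-free graphs and 1-Edge Contraction($\gamma_t$) is polynomial-time solvable on $H$-free graphs. -/

import Mathlib

open scoped SimpleGraph

/-- `D` is a total dominating set of `G`: every vertex has a neighbour in `D`. -/
def IsTotalDominatingSet {V : Type} (G : SimpleGraph V) (D : Finset V) : Prop :=
  ∀ v : V, ∃ w ∈ D, G.Adj v w

/-- The total domination number `γ_t(G)`: the least size of a total dominating set, and `⊤` if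
there is none (for a finite connected graph this happens only on a single vertex). -/
noncomputable def totalDominationNumber {V : Type} (G : SimpleGraph V) : ℕ∞ :=
  ⨅ (D : Finset V) (_ : IsTotalDominatingSet G D), (D.card : ℕ∞)

/-- The graph `G / uv`: the vertices `u` and `v` are removed and replaced by a new vertex `none`,
which is adjacent to exactly those remaining vertices that were adjacent to `u` or to `v`. -/
def contractEdge {V : Type} (G : SimpleGraph V) (u v : V) :
    SimpleGraph (Option {w : V // w ≠ u ∧ w ≠ v}) where
  Adj
    | some a, some b => G.Adj a b
    | some a, none => G.Adj u a ∨ G.Adj v a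
    | none, some b => G.Adj u b ∨ G.Adj v b
    | none, none => False
  symm := ⟨by
    rintro (_ | a) (_ | b) h
    · exact h
    · exact h
    · exact h
    · exact G.adj_symm h⟩
  loopless := ⟨by
    rintro (_ | a) h
    · exact h
    · exact G.irrefl h⟩

/-- The question of 1-Edge Contraction(`γ_t`): contracting some edge lowers `γ_t` by at least 1. -/
def HasReducingContraction {V : Type} (G : SimpleGraph V) : Prop :=
  ∃ u v : V, G.Adj u v ∧
    totalDominationNumber (contractEdge G u v) + 1 ≤ totalDominationNumber G

/-- A graph class: an isomorphism-closed class of finite connected simple graphs. -/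
structure GraphClass where
  Mem : ∀ {V : Type}, SimpleGraph V → Prop
  finite : ∀ {V : Type} {G : SimpleGraph V}, Mem G → Finite V
  connected : ∀ {V : Type} {G : SimpleGraph V}, Mem G → G.Connected
  iso : ∀ {V W : Type} {G : SimpleGraph V} {G' : SimpleGraph W}, (G ≃g G') → Mem G → Mem G'

/-- The class of `H`-free graphs: the finite connected graphs without an induced subgraph
isomorphic to `H`. -/
def freeClass {W : Type} (H : SimpleGraph W) : GraphClass where
  Mem {V} G := Finite V ∧ G.Connected ∧ ¬ H ⊴ G
  finite h := h.1
  connected h := h.2.1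
  iso := by
    rintro V V' G G' e ⟨hf, hc, hH⟩
    exact ⟨Finite.of_equiv V e.toEquiv, e.connected_iff.1 hc,
      fun h => hH (h.trans ⟨e.symm.toEmbedding⟩)⟩

/-- The class is closed under contraction of a single edge. -/
def GraphClass.ClosedUnderEdgeContraction (C : GraphClass) : Prop :=
  ∀ {V : Type} (G : SimpleGraph V), C.Mem G → ∀ u v : V, G.Adj u v → C.Mem (contractEdge G u v)

/-- The graphs of the class, presented on the vertex sets `Fin n`. -/
def GraphClass.Instance (C : GraphClass) : Type :=
  {x : Σ n : ℕ, SimpleGraph (Fin n) // C.Mem x.2}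

/-- A natural number, written in unary and terminated. -/
def encodeUnary (k : ℕ) : List Bool :=
  List.replicate k true ++ [false]

open Classical in
/-- A graph on `Fin n` as a bit string: `n` followed by the rows of the adjacency matrix. -/
noncomputable def encodeGraph (x : Σ n : ℕ, SimpleGraph (Fin n)) : List Bool :=
  encodeUnary x.1 ++
    (List.ofFn fun i : Fin x.1 => List.ofFn fun j : Fin x.1 => decide (x.2.Adj i j)).flatten

open Classical in
/-- The (promise) decision problem `P`, with instances `α` given as bit strings through `enc`, is
solvable in polynomial time: some Turing machine with a polynomial time bound in the length of the
input answers correctly on every instance. -/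
def PolyTimeDecidable {α : Type} (enc : α → List Bool) (P : α → Prop) : Prop :=
  Nonempty (Turing.TM2ComputableInPolyTime enc Computability.encodeBool fun a => decide (P a))

/-- 1-Edge Contraction(`γ_t`) is polynomial-time solvable on `C`. -/
def EdgeContractionPolyTimeOn (C : GraphClass) : Prop :=
  PolyTimeDecidable (fun x : C.Instance => encodeGraph x.1)
    (fun x : C.Instance => HasReducingContraction x.1.2)

/-- Total Dominating Set (given `G` in `C` and `k`, is there a total dominating set of size at most
`k`?) is polynomial-time solvable on `C`. -/
def TotalDominatingSetPolyTimeOn (C : GraphClass) : Prop :=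
  PolyTimeDecidable (fun x : C.Instance × ℕ => encodeUnary x.2 ++ encodeGraph x.1.1)
    (fun x : C.Instance × ℕ =>
      ∃ D : Finset (Fin x.1.1.1), IsTotalDominatingSet x.1.1.2 D ∧ D.card ≤ x.2)

/-!
An edge `uv` lowers the total domination number of a finite connected graph `G` exactly if some
`k` separates the two numbers: `G / uv` has a total dominating set of size at most `k` and `G` has
none (`hasReducingContraction_iff`). So the question is a search over `u`, `v` and `k`.

* If the class is closed under contraction and Total Dominating Set is solvable on it, then `k`
  ranges below the number of vertices, and the two conditions are decided by calling the given
  algorithm on `G` and on `G / uv`.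
* If `γ_t ≤ q` on the class, then `k` ranges below the constant `q`, and exhaustive search through
  all `k`-tuples of vertices is polynomial (`decides_reducibleBelow`).
* If the class consists of the `(H + K₁)`-free graphs, it is first tested whether `G` contains `H`
  as an induced subgraph. If not, the algorithm for `H`-free graphs applies. If so, all vertices
  outside a copy of `H` have a neighbour in the copy, whence `γ_t(G) ≤ 2 |V(H)|`
  (`hasTotalDominatingSet_of_not_isIndContained_sum`) and exhaustive search is polynomial.

Polynomial time means time on a multi-stack Turing machine, so these searches are carried out by
machines. Fragments of machine code are closed under sequencing, branching and loops; `Realizable R`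
says that some fragment carries out the transformation `R` of the memory in polynomial time. The
machines have, besides their work stacks, the stacks of a given machine `A`, the oracle, which is
called as a subroutine (`realizable_oracle`). `Performs R` is the same notion for transformations of
a state with named variables ranging over the vertices, and `Decides D P` says that the property `P`
of a graph and of values of the variables is decided in polynomial time whenever `D` holds.

`Decides` is closed under Boolean combinations and under quantification over the vertices, and
adjacency and equality are decidable; thus every property of graphs expressed by a fixed first-order
formula is decided in polynomial time. Conjunctions and case distinctions evaluate their second part
only when it is needed. This matters because the oracle is a promise algorithm: outside its class it
may fail to halt, so it must only be called on graphs known to belong to that class. Finally,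
`Decides.polyTimeDecidable` turns such a program into a machine for the encoded decision problem.
-/

namespace StackProgram

open Turing Function

/-! ### Composable fragments of stack machines -/

section Fragments

variable {K : Type} {Γ : K → Type} {Λ Λ' σ : Type}

/-- The memory of a stack machine: the internal variable and the stacks, without the label. -/
abbrev Memory (Γ : K → Type) (σ : Type) : Type := σ × ∀ k, List (Γ k)

/-- A configuration with its label separated from its memory. -/
def config (l : Option Λ) (s : Memory Γ σ) : TM2.Cfg Γ Λ σ := ⟨l, s.1, s.2⟩

/-- The statement that passes control to the label `x`, or halts if there is none. -/
def exitStmt : Option Λ → TM2.Stmt Γ Λ σ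
  | none => .halt
  | some l => .goto fun _ => l

/-- Rename the labels of a statement along `f` and replace `halt` by a jump to `x`. -/
def reroute (f : Λ → Λ') (x : Option Λ') : TM2.Stmt Γ Λ σ → TM2.Stmt Γ Λ' σ
  | .push k g q => .push k g (reroute f x q)
  | .peek k g q => .peek k g (reroute f x q)
  | .pop k g q => .pop k g (reroute f x q)
  | .load g q => .load g (reroute f x q)
  | .branch g q₁ q₂ => .branch g (reroute f x q₁) (reroute f x q₂)
  | .goto g => .goto fun v => f (g v)
  | .halt => exitStmt x

variable [DecidableEq K]

/-- A rerouted statement acts as before, except that it goes on at `x` where it used to halt. -/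
theorem stepAux_reroute (f : Λ → Λ') (x : Option Λ') (q : TM2.Stmt Γ Λ σ) (v : σ)
    (S : ∀ k, List (Γ k)) :
    TM2.stepAux (reroute f x q) v S =
      ⟨((TM2.stepAux q v S).l.map f).or x, (TM2.stepAux q v S).var, (TM2.stepAux q v S).stk⟩ := by
  induction q generalizing v S with
  | push k g q ih => exact ih _ _
  | peek k g q ih => exact ih _ _
  | pop k g q ih => exact ih _ _
  | load g q ih => exact ih _ _
  | branch g q₁ q₂ ih₁ ih₂ =>
    simp only [reroute, TM2.stepAux]
    cases g v
    · exact ih₂ _ _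
    · exact ih₁ _ _
  | goto g => rfl
  | halt => cases x <;> rfl

/-- `Steps m t c c'`: the program `m` leads from `c` to `c'` in exactly `t` steps. -/
inductive Steps (m : Λ → TM2.Stmt Γ Λ σ) : ℕ → TM2.Cfg Γ Λ σ → TM2.Cfg Γ Λ σ → Prop
  | refl (c) : Steps m 0 c c
  | head {t c c' c''} : TM2.step m c = some c' → Steps m t c' c'' → Steps m (t + 1) c c''

theorem Steps.trans {m : Λ → TM2.Stmt Γ Λ σ} {t t' : ℕ} {c c' c'' : TM2.Cfg Γ Λ σ}
    (h : Steps m t c c') (h' : Steps m t' c' c'') : Steps m (t + t') c c'' := by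
  induction h with
  | refl => simpa using h'
  | @head t _ _ _ hs _ ih =>
    rw [Nat.add_right_comm]
    exact .head hs (ih h')

theorem Steps.iterate {m : Λ → TM2.Stmt Γ Λ σ} {t : ℕ} {c c' : TM2.Cfg Γ Λ σ}
    (h : Steps m t c c') : (flip bind (TM2.step m))^[t] (some c) = some c' := by
  induction h with
  | refl => rfl
  | head hs _ ih =>
    rw [iterate_succ_apply, ← ih]
    congr 1

theorem steps_of_iterate {m : Λ → TM2.Stmt Γ Λ σ} {t : ℕ} {c c' : TM2.Cfg Γ Λ σ}
    (h : (flip bind (TM2.step m))^[t] (some c) = some c') : Steps m t c c' := by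
  induction t generalizing c with
  | zero => cases h; exact .refl _
  | succ t ih =>
    rw [iterate_succ_apply] at h
    have hb : flip bind (TM2.step m) (some c) = TM2.step m c := rfl
    rw [hb] at h
    cases hc : TM2.step m c with
    | some d => rw [hc] at h; exact .head hc (ih h)
    | none =>
      rw [hc, iterate_fixed (show flip bind (TM2.step m) none = none from rfl)] at h
      cases h

/-- A halting run of `m` is turned into a run with exit `x` of any program that contains
the rerouted code of `m`. -/
theorem Steps.reroute {m : Λ → TM2.Stmt Γ Λ σ} {m' : Λ' → TM2.Stmt Γ Λ' σ} {f : Λ → Λ'}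
    {x : Option Λ'} (hm : ∀ l, m' (f l) = reroute f x (m l)) {t : ℕ} {c c' : TM2.Cfg Γ Λ σ}
    (h : Steps m t c c') {l : Λ} (hl : c.l = some l) (hc' : c'.l = none) :
    Steps m' t ⟨some (f l), c.var, c.stk⟩ ⟨x, c'.var, c'.stk⟩ := by
  induction h generalizing l with
  | refl c => rw [hl] at hc'; cases hc'
  | @head t c d e hs hr ih =>
    obtain ⟨cl, v, S⟩ := c
    cases hl
    simp only [TM2.step, Option.some.injEq] at hs
    refine .head (c' := ⟨(d.l.map f).or x, d.var, d.stk⟩) ?_ ?_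
    · simp only [TM2.step, hm, stepAux_reroute, hs]
    · cases hd : d.l with
      | some l' => simpa using ih hd hc'
      | none =>
        cases hr with
        | refl => simpa using Steps.refl _
        | head hs' _ =>
          obtain ⟨dl, dv, dS⟩ := d
          cases hd
          cases hs'

/-- A program fragment with one entry; it is left by halting. -/
structure Fragment (Γ : K → Type) (σ : Type) where
  /-- the labels -/
  Label : Type
  /-- there are finitely many labels -/
  fintype : Fintype Label
  /-- the label where a run begins -/
  entry : Label
  /-- the code -/
  code : Label → TM2.Stmt Γ Label σ

namespace Fragment

/-- The fragment takes the memory `s` to `s'` in exactly `t` steps and is then left. -/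
def Runs (F : Fragment Γ σ) (t : ℕ) (s s' : Memory Γ σ) : Prop :=
  Steps F.code t (config (some F.entry) s) (config none s')

/-- A single statement as a fragment. -/
def single (q : TM2.Stmt Γ Unit σ) : Fragment Γ σ := ⟨Unit, inferInstance, (), fun _ => q⟩

/-- Run `F`, then `G`. -/
def seq (F G : Fragment Γ σ) : Fragment Γ σ where
  Label := F.Label ⊕ G.Label
  fintype := letI := F.fintype; letI := G.fintype; inferInstance
  entry := .inl F.entry
  code
    | .inl l => reroute .inl (some (.inr G.entry)) (F.code l)
    | .inr l => reroute .inr none (G.code l)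

/-- Run `F` if the internal variable satisfies `p`, and `G` otherwise. -/
def ite (p : σ → Bool) (F G : Fragment Γ σ) : Fragment Γ σ where
  Label := Option (F.Label ⊕ G.Label)
  fintype := letI := F.fintype; letI := G.fintype; inferInstance
  entry := none
  code
    | none => .goto fun v => cond (p v) (some (.inl F.entry)) (some (.inr G.entry))
    | some (.inl l) => reroute (fun l => some (.inl l)) none (F.code l)
    | some (.inr l) => reroute (fun l => some (.inr l)) none (G.code l)

/-- Pop the stack `k` and update the internal variable by `f`; if it then satisfies `p`,
run `F` and start again. -/
def loop (k : K) (f : σ → Option (Γ k) → σ) (p : σ → Bool) (F : Fragment Γ σ) : Fragment Γ σ where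
  Label := Option F.Label
  fintype := letI := F.fintype; inferInstance
  entry := none
  code
    | none => .pop k f (.branch p (.goto fun _ => some F.entry) .halt)
    | some l => reroute some (some none) (F.code l)

theorem runs_single {q : TM2.Stmt Γ Unit σ} {s s' : Memory Γ σ}
    (h : TM2.stepAux q s.1 s.2 = config none s') : (single q).Runs 1 s s' :=
  .head (congrArg some h) (.refl _)

theorem Runs.seq {F G : Fragment Γ σ} {t t' : ℕ} {s s' s'' : Memory Γ σ}
    (h : F.Runs t s s') (h' : G.Runs t' s' s'') : (F.seq G).Runs (t + t') s s'' :=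
  (Steps.reroute (m' := (F.seq G).code) (fun _ => rfl) h rfl rfl).trans
    (Steps.reroute (m' := (F.seq G).code) (fun _ => rfl) h' rfl rfl)

theorem Runs.ite_true {p : σ → Bool} {F : Fragment Γ σ} (G : Fragment Γ σ) {t : ℕ}
    {s s' : Memory Γ σ} (hp : p s.1 = true) (h : F.Runs t s s') :
    (ite p F G).Runs (t + 1) s s' :=
  .head (by simp [ite, config, TM2.step, hp])
    (Steps.reroute (m' := (ite p F G).code) (f := fun l => some (.inl l)) (fun _ => rfl) h rfl rfl)

theorem Runs.ite_false {p : σ → Bool} (F : Fragment Γ σ) {G : Fragment Γ σ} {t : ℕ}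
    {s s' : Memory Γ σ} (hp : p s.1 = false) (h : G.Runs t s s') :
    (ite p F G).Runs (t + 1) s s' :=
  .head (by simp [ite, config, TM2.step, hp])
    (Steps.reroute (m' := (ite p F G).code) (f := fun l => some (.inr l)) (fun _ => rfl) h rfl rfl)

end Fragment

/-- The memory after popping the stack `k` and updating the internal variable by `f`. -/
def popped (k : K) (f : σ → Option (Γ k) → σ) (s : Memory Γ σ) : Memory Γ σ :=
  (f s.1 (s.2 k).head?, update s.2 k (s.2 k).tail)

/-- `LoopRel k f p R m s s'`: a loop controlled by `k`, `f` and `p` whose body acts by `R`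
takes `s` to `s'` in `m` rounds. -/
inductive LoopRel (k : K) (f : σ → Option (Γ k) → σ) (p : σ → Bool)
    (R : Memory Γ σ → Memory Γ σ → Prop) : ℕ → Memory Γ σ → Memory Γ σ → Prop
  | done {s} : p (popped k f s).1 = false → LoopRel k f p R 0 s (popped k f s)
  | round {m s s' s''} : p (popped k f s).1 = true → R (popped k f s) s' →
      LoopRel k f p R m s' s'' → LoopRel k f p R (m + 1) s s''

theorem LoopRel.runs {k : K} {f : σ → Option (Γ k) → σ} {p : σ → Bool}
    {R : Memory Γ σ → Memory Γ σ → Prop} {F : Fragment Γ σ} {B : ℕ}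
    (hF : ∀ s s', R s s' → ∃ t ≤ B, F.Runs t s s') {m : ℕ} {s s' : Memory Γ σ}
    (h : LoopRel k f p R m s s') :
    ∃ t ≤ m * (B + 1) + 1, (F.loop k f p).Runs t s s' := by
  induction h with
  | done hp =>
    refine ⟨1, by simp, .head ?_ (.refl _)⟩
    simp only [popped] at hp
    simp [Fragment.loop, config, TM2.step, popped, hp]
  | @round m s s₁ s₂ hp hR _ ih =>
    obtain ⟨t, ht, h⟩ := hF _ _ hR
    obtain ⟨t', ht', h'⟩ := ih
    refine ⟨t + t' + 1, by rw [Nat.add_mul]; omega, .head ?_ ((Steps.reroute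
      (m' := (F.loop k f p).code) (f := some) (fun _ => rfl) h rfl rfl).trans h')⟩
    simp only [popped] at hp
    simp [Fragment.loop, config, TM2.step, hp]
    exact ⟨rfl, rfl⟩

end Fragments

/-! ### Memory transformations realizable in polynomial time -/

theorem eval_mono (p : Polynomial ℕ) {a b : ℕ} (h : a ≤ b) : p.eval a ≤ p.eval b := by
  rw [Polynomial.eval_eq_sum, Polynomial.eval_eq_sum]
  exact Finset.sum_le_sum fun i _ => Nat.mul_le_mul_left _ (Nat.pow_le_pow_left h i)

section Realizable

variable {K : Type} [DecidableEq K] {Γ : K → Type} {σ : Type}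

/-- Some fragment realizes `R` in polynomial time: whenever `R n s s'` holds, it takes `s` to `s'`
within a number of steps polynomial in the size parameter `n`. The domain of the transformation
is part of `R`: nothing is asked of memories that `R n` relates to none. -/
def Realizable (R : ℕ → Memory Γ σ → Memory Γ σ → Prop) : Prop :=
  ∃ (F : Fragment Γ σ) (p : Polynomial ℕ), ∀ n s s', R n s s' → ∃ t ≤ p.eval n, F.Runs t s s'

variable {R R' : ℕ → Memory Γ σ → Memory Γ σ → Prop}

theorem Realizable.mono (h : Realizable R) (hR : ∀ n s s', R' n s s' → R n s s') :
    Realizable R' := by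
  obtain ⟨F, p, h⟩ := h
  exact ⟨F, p, fun n s s' hs => h n s s' (hR n s s' hs)⟩

theorem Realizable.seq (h : Realizable R) (h' : Realizable R') :
    Realizable fun n s s'' => ∃ s', R n s s' ∧ R' n s' s'' := by
  obtain ⟨F, p, h⟩ := h
  obtain ⟨F', p', h'⟩ := h'
  refine ⟨F.seq F', p + p', fun n s s'' ⟨s', hs, hs'⟩ => ?_⟩
  obtain ⟨t, ht, hr⟩ := h n _ _ hs
  obtain ⟨t', ht', hr'⟩ := h' n _ _ hs'
  exact ⟨t + t', by rw [Polynomial.eval_add]; omega, hr.seq hr'⟩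

theorem Realizable.ite (c : σ → Bool) (h : Realizable R) (h' : Realizable R') :
    Realizable fun n s s' => (c s.1 = true ∧ R n s s') ∨ (c s.1 = false ∧ R' n s s') := by
  obtain ⟨F, p, h⟩ := h
  obtain ⟨F', p', h'⟩ := h'
  refine ⟨.ite c F F', p + p' + 1, fun n s s'' hs => ?_⟩
  rcases hs with ⟨hc, hs⟩ | ⟨hc, hs⟩
  · obtain ⟨t, ht, hr⟩ := h n _ _ hs
    exact ⟨t + 1, by simp only [Polynomial.eval_add, Polynomial.eval_one]; omega, hr.ite_true _ hc⟩
  · obtain ⟨t, ht, hr⟩ := h' n _ _ hs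
    exact ⟨t + 1, by simp only [Polynomial.eval_add, Polynomial.eval_one]; omega,
      hr.ite_false _ hc⟩

theorem realizable_single (q : TM2.Stmt Γ Unit σ) :
    Realizable fun _ s s' => TM2.stepAux q s.1 s.2 = config none s' :=
  ⟨.single q, 1, fun _ _ _ h => ⟨1, by simp, Fragment.runs_single h⟩⟩

theorem Realizable.loop (k : K) (f : σ → Option (Γ k) → σ) (c : σ → Bool) (B : Polynomial ℕ)
    (h : Realizable R) :
    Realizable fun n s s' => ∃ m ≤ B.eval n, LoopRel k f c (R n) m s s' := by
  obtain ⟨F, p, h⟩ := h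
  refine ⟨F.loop k f c, B * (p + 1) + 1, fun n s s' ⟨m, hm, hs⟩ => ?_⟩
  obtain ⟨t, ht, hr⟩ := hs.runs (h n)
  refine ⟨t, ht.trans ?_, hr⟩
  simp only [Polynomial.eval_add, Polynomial.eval_mul, Polynomial.eval_one]
  gcongr

end Realizable

/-! ### The machine with an oracle -/

section Oracle

/-- The work stacks of the machines below. `inp` holds the input and in the end the answer; `num`
holds the number of vertices in unary, `mat` the reversed adjacency matrix, `mat'` the part of it
that has been read; `tmp` and `tmp'` are scratch; `acc` saves truth values; `var i` holds the value
of the variable `i` in unary. -/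
inductive Stk (ι : Type) : Type
  | inp | num | mat | mat' | tmp | tmp' | acc
  | var (i : ι)
  deriving DecidableEq, Fintype

variable {ι : Type} (A : TM2ComputableAux Bool Bool)

/-- The stack alphabets: bits on the work stacks, and the alphabets of the oracle machine `A` on
its own stacks. -/
abbrev Alphabet (ι : Type) (A : TM2ComputableAux Bool Bool) : Stk ι ⊕ A.tm.K → Type
  | .inl _ => Bool
  | .inr k => A.tm.Γ k

/-- The internal variable: a flag holding the last truth value computed, a register for the symbol
that is being moved, and the internal variable of the oracle machine `A`. -/
abbrev Var (A : TM2ComputableAux Bool Bool) : Type := (Bool × Option Bool) × A.tm.σ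

variable {A}

/-- Work stacks and oracle stacks together. -/
def allStacks (S : Stk ι → List Bool) (S' : ∀ k, List (A.tm.Γ k)) : ∀ k, List (Alphabet ι A k)
  | .inl k => S k
  | .inr k => S' k

@[simp]
theorem allStacks_inl (S : Stk ι → List Bool) (S' : ∀ k, List (A.tm.Γ k)) (k : Stk ι) :
    allStacks S S' (.inl k) = S k := rfl

@[simp]
theorem allStacks_inr (S : Stk ι → List Bool) (S' : ∀ k, List (A.tm.Γ k)) (k : A.tm.K) :
    allStacks S S' (.inr k : Stk ι ⊕ A.tm.K) = S' k := rfl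

variable [DecidableEq ι]

@[simp]
theorem update_allStacks_inl (S : Stk ι → List Bool) (S' : ∀ k, List (A.tm.Γ k)) (k : Stk ι)
    (l : List Bool) : update (allStacks S S') (.inl k) l = allStacks (update S k l) S' := by
  funext x
  rcases x with x | x
  · by_cases h : x = k
    · subst h; simp
    · simp [h]
  · simp

@[simp]
theorem update_allStacks_inr (S : Stk ι → List Bool) (S' : ∀ k, List (A.tm.Γ k)) (k : A.tm.K)
    (l : List (A.tm.Γ k)) :
    update (allStacks S S') (.inr k) l = allStacks S (update S' k l) := by
  funext x
  rcases x with x | x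
  · simp
  · by_cases h : x = k
    · subst h; simp
    · simp [h]

/-- The stacks of the oracle machine `A` at the start of its run on `o`. -/
def oracleInput (A : TM2ComputableAux Bool Bool) (o : List Bool) : ∀ k, List (A.tm.Γ k) :=
  (initList A.tm (o.map A.inputAlphabet.invFun)).stk

/-- The stacks of the oracle machine `A` when it has answered `c`. -/
def oracleOutput (A : TM2ComputableAux Bool Bool) (c : Bool) : ∀ k, List (A.tm.Γ k) :=
  (haltList A.tm ([c].map A.outputAlphabet.invFun)).stk

/-- The memory with flag `b`, register `r`, work stacks `S`, and the oracle ready to be started on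
the input `o`. -/
def mem (A : TM2ComputableAux Bool Bool) (b : Bool) (r : Option Bool) (S : Stk ι → List Bool)
    (o : List Bool) : Memory (Alphabet ι A) (Var A) :=
  (((b, r), A.tm.initialState), allStacks S (oracleInput A o))

/-! #### Transferring the contents of a stack -/

/-- Push the register on each of the stacks `bs` and empty the register. -/
def pushAll : List (Stk ι) → TM2.Stmt (Alphabet ι A) Unit (Var A)
  | [] => .load (fun v => ((v.1.1, none), v.2)) .halt
  | k :: bs => .push (.inl k) (fun v => v.1.2.getD false) (pushAll bs)

theorem stepAux_pushAll (bs : List (Stk ι)) (hbs : bs.Nodup) (b x : Bool) (S : Stk ι → List Bool)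
    (o : List Bool) :
    TM2.stepAux (pushAll bs) (mem A b (some x) S o).1 (mem A b (some x) S o).2 =
      config none (mem A b none (fun k => if k ∈ bs then x :: S k else S k) o) := by
  induction bs generalizing S with
  | nil => simp [pushAll, mem, config]
  | cons k bs ih =>
    have h := ih hbs.of_cons (update S k (x :: S k))
    simp only [pushAll, TM2.stepAux, mem, allStacks_inl, Option.getD_some,
      update_allStacks_inl] at h ⊢
    rw [h]
    congr 3
    funext j
    have hk := (List.nodup_cons.1 hbs).1
    by_cases hj : j = k
    · subst hj; simp [hk]
    · simp [hj]

/-- Pop from a stack into the register. -/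
def toRegister (v : Var A) (x : Option Bool) : Var A := ((v.1.1, x), v.2)

theorem popped_mem (a : Stk ι) (b : Bool) (r : Option Bool) (S : Stk ι → List Bool)
    (o : List Bool) :
    popped (.inl a) toRegister (mem A b r S o) = mem A b (S a).head? (update S a (S a).tail) o := by
  simp [popped, mem, toRegister]

/-- The stack `a` can be emptied onto the stacks `bs`. -/
theorem realizable_drain (a : Stk ι) (bs : List (Stk ι)) (ha : a ∉ bs) (hbs : bs.Nodup)
    (B : Polynomial ℕ) :
    Realizable fun n s s' => ∃ b S o, (S a).length ≤ B.eval n ∧ s = mem A b none S o ∧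
      s' = mem A b none
        (fun k => if k = a then [] else if k ∈ bs then (S a).reverse ++ S k else S k) o := by
  refine ((realizable_single (pushAll bs)).loop (.inl a) toRegister
    (fun v => v.1.2.isSome) B).mono ?_
  rintro n _ _ ⟨b, S, o, hl, rfl, rfl⟩
  refine ⟨_, hl, ?_⟩
  clear hl
  generalize hL : S a = L
  induction L generalizing S with
  | nil =>
    have h := LoopRel.done (k := (.inl a : Stk ι ⊕ A.tm.K)) (f := toRegister)
      (p := fun v : Var A => v.1.2.isSome) (s := mem A b none S o)
      (R := fun s s' => TM2.stepAux (pushAll bs) s.1 s.2 = config none s')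
      (by rw [popped_mem, hL]; rfl)
    rw [popped_mem, hL] at h
    rw [List.length_nil]
    change LoopRel _ _ _ _ 0 _ (mem A b none _ o) at h
    convert h using 2
    funext k
    by_cases hk : k = a
    · subst hk; simp
    · simp [hk]
  | cons x L ih =>
    refine .round (s' := mem A b none
      (fun k => if k ∈ bs then x :: (update S a L) k else (update S a L) k) o) ?_ ?_ ?_
    · rw [popped_mem, hL]; rfl
    · rw [popped_mem, hL]; exact stepAux_pushAll bs hbs b x _ o
    · convert ih _ ?_ using 2
      · funext k
        by_cases hk : k = a
        · simp [hk]
        · by_cases hk' : k ∈ bs <;> simp [hk, hk']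
      · simp [ha]

/-! #### Calling the oracle -/

/-- A statement of the oracle machine as a statement of the machine with an oracle. -/
def liftStmt {Λ : Type} : TM2.Stmt A.tm.Γ Λ A.tm.σ → TM2.Stmt (Alphabet ι A) Λ (Var A)
  | .push k g q => .push (.inr k) (fun v => g v.2) (liftStmt q)
  | .peek k g q => .peek (.inr k) (fun v x => (v.1, g v.2 x)) (liftStmt q)
  | .pop k g q => .pop (.inr k) (fun v x => (v.1, g v.2 x)) (liftStmt q)
  | .load g q => .load (fun v => (v.1, g v.2)) (liftStmt q)
  | .branch g q₁ q₂ => .branch (fun v => g v.2) (liftStmt q₁) (liftStmt q₂)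
  | .goto g => .goto fun v => g v.2
  | .halt => .halt

theorem stepAux_liftStmt {Λ : Type} (q : TM2.Stmt A.tm.Γ Λ A.tm.σ) (w : Bool × Option Bool)
    (v : A.tm.σ) (S : Stk ι → List Bool) (S' : ∀ k, List (A.tm.Γ k)) :
    TM2.stepAux (liftStmt q) (w, v) (allStacks S S') =
      ⟨(TM2.stepAux q v S').l, (w, (TM2.stepAux q v S').var),
        allStacks S (TM2.stepAux q v S').stk⟩ := by
  induction q generalizing v S' with
  | push k g q ih => simp [liftStmt, ih]
  | peek k g q ih => simp [liftStmt, ih]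
  | pop k g q ih => simp [liftStmt, ih]
  | load g q ih => simp [liftStmt, ih]
  | branch g q₁ q₂ ih₁ ih₂ => cases h : g v <;> simp [liftStmt, ih₁, ih₂, h]
  | goto g => rfl
  | halt => rfl

/-- A run of the oracle machine within the machine with an oracle leaves the work stacks, the flag
and the register alone. -/
theorem steps_liftStmt {m : A.tm.Λ → TM2.Stmt A.tm.Γ A.tm.Λ A.tm.σ} {t : ℕ}
    {c c' : TM2.Cfg A.tm.Γ A.tm.Λ A.tm.σ} (h : Steps m t c c') (w : Bool × Option Bool)
    (S : Stk ι → List Bool) :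
    Steps (fun l => liftStmt (m l)) t ⟨c.l, (w, c.var), allStacks S c.stk⟩
      ⟨c'.l, (w, c'.var), allStacks S c'.stk⟩ := by
  induction h with
  | refl c => exact .refl _
  | @head t c d e hs _ ih =>
    refine .head ?_ ih
    obtain ⟨_ | l, v, S'⟩ := c
    · cases hs
    · simp only [TM2.step, Option.some.injEq] at hs ⊢
      rw [stepAux_liftStmt, hs]

/-- The oracle can be run on the input prepared for it, as long as its running time is
polynomially bounded; its answer is left in the flag. -/
theorem realizable_oracle (B : Polynomial ℕ) :
    Realizable fun n s s' => ∃ (b c : Bool) (S : Stk ι → List Bool) (o : List Bool),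
      Nonempty (TM2OutputsInTime A.tm (o.map A.inputAlphabet.invFun)
        (some ([c].map A.outputAlphabet.invFun)) (B.eval n)) ∧
      s = mem A b none S o ∧ s' = mem A c none S [] := by
  have h₁ : Realizable fun n (s s' : Memory (Alphabet ι A) (Var A)) =>
      ∃ (b c : Bool) (S : Stk ι → List Bool) (o : List Bool),
      Nonempty (TM2OutputsInTime A.tm (o.map A.inputAlphabet.invFun)
        (some ([c].map A.outputAlphabet.invFun)) (B.eval n)) ∧
      s = mem A b none S o ∧ s' = (((b, none), A.tm.initialState),
        allStacks S (oracleOutput A c)) := by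
    refine ⟨⟨A.tm.Λ, A.tm.ΛFin, A.tm.main, fun l => liftStmt (A.tm.m l)⟩, B, ?_⟩
    rintro n _ _ ⟨b, c, S, o, ⟨h⟩, rfl, rfl⟩
    exact ⟨h.steps, h.steps_le_m,
      steps_liftStmt (steps_of_iterate h.evals_in_steps) (b, none) S⟩
  refine (h₁.seq (realizable_single (.pop (.inr A.tm.k₁)
    (fun v x => (((x.map A.outputAlphabet).getD false, none), v.2)) .halt))).mono ?_
  rintro n _ _ ⟨b, c, S, o, h, rfl, rfl⟩
  refine ⟨_, ⟨b, c, S, o, h, rfl, rfl⟩, ?_⟩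
  have hS : update (oracleOutput A c) A.tm.k₁ [] = oracleInput A [] := by
    funext k
    by_cases hk : k = A.tm.k₁
    · subst hk
      by_cases hk' : A.tm.k₁ = A.tm.k₀
      · simp only [update_self, oracleInput, initList]
        rw [dif_pos hk']
        generalize A.tm.k₁ = x at hk'
        subst hk'
        rfl
      · simp [oracleInput, oracleOutput, initList, hk']
    · by_cases hk' : k = A.tm.k₀
      · subst hk'; simp [oracleInput, oracleOutput, initList, haltList, hk]
      · simp [oracleInput, oracleOutput, initList, haltList, hk, hk']
  have hH : oracleOutput A c A.tm.k₁ =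
      [A.outputAlphabet.symm c] := by
    simp [oracleOutput, haltList]
  simp only [TM2.stepAux, mem, config, allStacks_inr, update_allStacks_inr, hH, List.tail_cons, hS]
  simp

end Oracle

/-! ### Programs on variables, truth values and the adjacency matrix -/

section Programs

variable {ι : Type} {A : TM2ComputableAux Bool Bool}

/-- The data on which the programs operate: the last truth value, the values of the variables, the
input prepared for the oracle, the saved truth values, and the unread (reversed) and read parts of
the adjacency matrix. -/
structure State (ι : Type) where
  /-- the last truth value computed -/
  flag : Bool
  /-- the values of the variables -/
  env : ι → ℕ
  /-- the input prepared for the oracle -/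
  out : List Bool
  /-- saved truth values -/
  acc : List Bool
  /-- the unread part of the adjacency matrix, last bit first -/
  mat : List Bool
  /-- the part of the adjacency matrix that has been read -/
  mat' : List Bool

namespace State

/-- The work stacks that represent the state `h` of a program on a graph with `n` vertices. -/
def stk (n : ℕ) (h : State ι) : Stk ι → List Bool
  | .inp => []
  | .num => List.replicate n true
  | .mat => h.mat
  | .mat' => h.mat'
  | .tmp => []
  | .tmp' => []
  | .acc => h.acc
  | .var i => List.replicate (h.env i) true

/-- The memory that represents the state `h` of a program on a graph with `n` vertices. -/
def mem (A : TM2ComputableAux Bool Bool) (n : ℕ) (h : State ι) :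
    Memory (Alphabet ι A) (Var A) :=
  StackProgram.mem A h.flag none (h.stk n) h.out

end State

variable [DecidableEq ι]

/-- Assign the value `a` to the variable `i`. -/
@[simps]
def State.set (s : State ι) (i : ι) (a : ℕ) : State ι := { s with env := update s.env i a }

theorem State.set_eq_self {s : State ι} {i : ι} {a : ℕ} (h : s.env i = a) : s.set i a = s := by
  subst h
  simp [State.set]

/-- Some fragment realizes the transformation `R` of states in polynomial time. -/
def Performs (A : TM2ComputableAux Bool Bool) (R : ℕ → State ι → State ι → Prop) : Prop :=
  Realizable fun n s s' => ∃ h h', R n h h' ∧ s = h.mem A n ∧ s' = h'.mem A n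

namespace Performs

variable {R R' : ℕ → State ι → State ι → Prop}

theorem mono (h : Performs A R) (hR : ∀ n s s', R' n s s' → R n s s') : Performs A R' :=
  Realizable.mono h fun n _ _ ⟨a, b, hab, hs⟩ => ⟨a, b, hR n a b hab, hs⟩

theorem seq (h : Performs A R) (h' : Performs A R') :
    Performs A fun n s s'' => ∃ s', R n s s' ∧ R' n s' s'' :=
  (Realizable.seq h h').mono fun n _ _ ⟨a, b, ⟨c, hac, hcb⟩, hs, hs'⟩ =>
    ⟨c.mem A n, ⟨a, c, hac, hs, rfl⟩, ⟨c, b, hcb, rfl, hs'⟩⟩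

/-- Branching on the flag. -/
theorem ite (h : Performs A R) (h' : Performs A R') :
    Performs A fun n s s' => (s.flag = true ∧ R n s s') ∨ (s.flag = false ∧ R' n s s') :=
  (Realizable.ite (fun v => v.1.1) h h').mono fun n s s' ⟨a, b, hab, hs, hs'⟩ => by
    subst hs
    exact hab.imp (fun hab => ⟨hab.1, a, b, hab.2, rfl, hs'⟩)
      (fun hab => ⟨hab.1, a, b, hab.2, rfl, hs'⟩)

/-- A transformation carried out by a single statement. -/
theorem of_stmt (q : TM2.Stmt (Alphabet ι A) Unit (Var A))
    (hq : ∀ n s s', R n s s' →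
      TM2.stepAux q (s.mem A n).1 (s.mem A n).2 = config none (s'.mem A n)) : Performs A R :=
  (realizable_single q).mono fun n _ _ ⟨a, b, hab, hs, hs'⟩ => by
    subst hs hs'; exact hq n a b hab

end Performs

/-- Empty the register and halt. -/
def clearRegister : TM2.Stmt (Alphabet ι A) Unit (Var A) :=
  .load (fun v => ((v.1.1, none), v.2)) .halt

theorem performs_setFlag (f : Bool → Bool) :
    Performs (ι := ι) A fun _ s s' => s' = { s with flag := f s.flag } :=
  .of_stmt (.load (fun v => ((f v.1.1, none), v.2)) .halt) (by rintro n s _ rfl; rfl)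

theorem performs_saveFlag :
    Performs (ι := ι) A fun _ s s' => s' = { s with acc := s.flag :: s.acc } :=
  .of_stmt (.push (.inl .acc) (fun v => v.1.1) .halt) (by
    rintro n s _ rfl
    simp only [TM2.stepAux, State.mem, mem, config, allStacks_inl, update_allStacks_inl]
    congr 2
    funext k
    cases k <;> simp [State.stk])

theorem performs_restoreFlag :
    Performs (ι := ι) A fun _ s s' => ∃ b l, s.acc = b :: l ∧ s' = { s with flag := b, acc := l } :=
  .of_stmt (.pop (.inl .acc) (fun v x => ((x.getD false, none), v.2)) .halt) (by
    rintro n s _ ⟨b, l, h, rfl⟩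
    simp only [TM2.stepAux, State.mem, mem, config, allStacks_inl, update_allStacks_inl]
    congr 2
    · simp [State.stk, h]
    · funext k
      cases k <;> simp [State.stk, h])

/-- Form the disjunction of the flag and the truth value saved last. -/
theorem performs_orFlag :
    Performs (ι := ι) A fun _ s s' =>
      ∃ b l, s.acc = b :: l ∧ s' = { s with acc := (b || s.flag) :: l } :=
  .of_stmt (.pop (.inl .acc) (fun v x => ((v.1.1, x), v.2))
      (.push (.inl .acc) (fun v => v.1.2.getD false || v.1.1) clearRegister)) (by
    rintro n s _ ⟨b, l, h, rfl⟩
    simp only [TM2.stepAux, State.mem, mem, config, allStacks_inl, update_allStacks_inl,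
      clearRegister]
    congr 2
    funext k
    cases k <;> simp [State.stk, h])

/-- Read the last unread bit of the matrix and form its conjunction with the flag. -/
theorem performs_readBit :
    Performs (ι := ι) A fun _ s s' => ∃ b l, s.mat = b :: l ∧
      s' = { s with flag := s.flag && b, mat := l, mat' := b :: s.mat' } :=
  .of_stmt (.pop (.inl .mat) (fun v x => ((v.1.1, x), v.2))
      (.push (.inl .mat') (fun v => v.1.2.getD false)
        (.load (fun v => ((v.1.1 && v.1.2.getD false, none), v.2)) .halt))) (by
    rintro n s _ ⟨b, l, h, rfl⟩
    simp only [TM2.stepAux, State.mem, mem, config, allStacks_inl, update_allStacks_inl]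
    congr 2
    · simp [State.stk, h]
    · funext k
      cases k <;> simp [State.stk, h])

theorem update_oracleInput (b : Bool) (o : List Bool) :
    update (oracleInput A o) A.tm.k₀ (A.inputAlphabet.symm b :: oracleInput A o A.tm.k₀) =
      oracleInput A (b :: o) := by
  funext k
  by_cases hk : k = A.tm.k₀
  · subst hk; simp [oracleInput, initList]
  · simp [oracleInput, initList, hk]

/-- Put a bit that depends on the flag in front of the oracle input. -/
theorem performs_emit (f : Bool → Bool) :
    Performs (ι := ι) A fun _ s s' => s' = { s with flag := false, out := f s.flag :: s.out } :=
  .of_stmt (.push (.inr A.tm.k₀) (fun v => A.inputAlphabet.symm (f v.1.1))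
      (.load (fun v => ((false, none), v.2)) .halt)) (by
    rintro n s _ rfl
    simp only [TM2.stepAux, State.mem, mem, config, allStacks_inr, update_allStacks_inr,
      update_oracleInput]
    rfl)

/-- A call of the oracle consumes the prepared input, so that the next input can be prepared from
scratch. -/
theorem performs_oracle (B : Polynomial ℕ) :
    Performs (ι := ι) A fun n s s' => ∃ c : Bool,
      Nonempty (TM2OutputsInTime A.tm (s.out.map A.inputAlphabet.invFun)
        (some ([c].map A.outputAlphabet.invFun)) (B.eval n)) ∧
      s' = { s with flag := c, out := [] } := by
  refine (realizable_oracle B).mono ?_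
  rintro n _ _ ⟨s, _, ⟨c, hc, rfl⟩, rfl, rfl⟩
  exact ⟨s.flag, c, s.stk n, s.out, hc, rfl, rfl⟩

/-- Return the part of the matrix that has been read. -/
theorem performs_rewind (B : Polynomial ℕ) :
    Performs (ι := ι) A fun n s s' => s.mat'.length ≤ B.eval n ∧
      s' = { s with mat := s.mat'.reverse ++ s.mat, mat' := [] } := by
  refine (realizable_drain .mat' [.mat] (by simp) (by simp) B).mono ?_
  rintro n _ _ ⟨s, _, ⟨hl, rfl⟩, rfl, rfl⟩
  refine ⟨s.flag, s.stk n, s.out, hl, rfl, ?_⟩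
  simp only [State.mem]
  congr 1
  funext k
  cases k <;> simp [State.stk]

/-! #### Comparing variables -/

/-- Subtract the variable `i` from the variable `j`, storing what is removed on the scratch
stacks. -/
theorem realizable_sub {i j : ι} (hij : i ≠ j) :
    Realizable fun n (s s' : Memory (Alphabet ι A) (Var A)) =>
      ∃ b S o a c, a ≤ n ∧ S (.var i) = List.replicate a true ∧
        S (.var j) = List.replicate c true ∧ s = mem A b none S o ∧
        s' = mem A b none (update (update (update (update S
          (.var j) (List.replicate (c - a) true)) (.var i) [])
          .tmp (List.replicate a true ++ S .tmp)) .tmp' (List.replicate (min a c) true ++ S .tmp'))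
          o := by
  refine ((realizable_single (Γ := Alphabet ι A) (σ := Var A) (.push (.inl .tmp) (fun _ => true)
    (.pop (.inl (.var j)) toRegister (.branch (fun v => v.1.2.isSome)
      (.push (.inl .tmp') (fun _ => true) clearRegister) clearRegister)))).loop (.inl (.var i))
    toRegister (fun v => v.1.2.isSome) Polynomial.X).mono ?_
  rintro n _ _ ⟨b, S, o, a, c, ha, hi, hj, rfl, rfl⟩
  refine ⟨a, by simpa using ha, ?_⟩
  clear ha
  induction a generalizing S c with
  | zero =>
    have h := fun R => LoopRel.done (k := (.inl (.var i) : Stk ι ⊕ A.tm.K)) (f := toRegister)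
      (p := fun v : Var A => v.1.2.isSome) (s := mem A b none S o) (R := R)
      (by rw [popped_mem, hi]; rfl)
    rw [popped_mem, hi] at h
    change ∀ R, LoopRel _ _ _ R 0 _ (mem A b none _ o) at h
    convert h _ using 2
    funext k
    by_cases hk : k = .var i
    · subst hk; simp
    · by_cases hk' : k = .var j
      · subst hk'; simp [hk, hj]
      · by_cases h1 : k = .tmp
        · subst h1; simp
        · by_cases h2 : k = .tmp'
          · subst h2; simp
          · simp [hk, hk', h1, h2]
  | succ a ih =>
    refine .round (s' := mem A b none (update (update (update (update S
          (.var j) (List.replicate (c - 1) true)) (.var i) (List.replicate a true))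
          .tmp (true :: S .tmp)) .tmp' (List.replicate (min 1 c) true ++ S .tmp')) o) ?_ ?_ ?_
    · rw [popped_mem, hi]; rfl
    · rw [popped_mem, hi]
      have hji : (Stk.var j : Stk ι) ≠ .var i := by simpa using hij.symm
      cases c with
      | zero =>
        simp only [TM2.stepAux, mem, allStacks_inl, update_allStacks_inl, toRegister, ne_eq,
          reduceCtorEq, not_false_eq_true, update_of_ne, hji, hj, List.replicate_zero,
          List.head?_nil, Option.isSome_none, cond_false, clearRegister, config]
        congr 2
        funext k
        by_cases h1 : k = .var i
        · subst h1; simp [hji.symm]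
        · by_cases h2 : k = .var j
          · subst h2; simp [h1]
          · by_cases h3 : k = .tmp
            · subst h3; simp
            · by_cases h4 : k = .tmp'
              · subst h4; simp
              · simp [h1, h2, h3, h4]
      | succ c =>
        simp only [TM2.stepAux, mem, allStacks_inl, update_allStacks_inl, toRegister, ne_eq,
          reduceCtorEq, not_false_eq_true, update_of_ne, hji, hj, List.replicate_succ,
          List.head?_cons, Option.isSome_some, cond_true, clearRegister, config]
        congr 2
        funext k
        by_cases h1 : k = .var i
        · subst h1; simp [hji.symm]
        · by_cases h2 : k = .var j
          · subst h2; simp [h1]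
          · by_cases h3 : k = .tmp
            · subst h3; simp
            · by_cases h4 : k = .tmp'
              · subst h4; simp
              · simp [h1, h2, h3, h4]
    · have hji : j ≠ i := hij.symm
      convert ih _ (c - 1) ?_ ?_ using 2
      · funext k
        by_cases h1 : k = .var i
        · subst h1; simp
        · by_cases h2 : k = .var j
          · subst h2; simp [h1]; omega
          · by_cases h3 : k = .tmp
            · subst h3; simp [List.replicate_succ']
            · by_cases h4 : k = .tmp'
              · subst h4
                simp only [update_self, ← List.append_assoc, List.replicate_append_replicate]
                congr 2
                omega
              · simp [h1, h2, h3, h4]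
      · simp
      · simp [hji]

/-- Comparison of two variables. -/
theorem performs_lt {i j : ι} (hij : i ≠ j) :
    Performs A fun n s s' => s.env i ≤ n ∧ s.env j ≤ n ∧
      s' = { s with flag := decide (s.env i < s.env j) } := by
  have hji : j ≠ i := hij.symm
  refine (((realizable_sub hij).seq (realizable_single (.peek (.inl (.var j))
    (fun v x => ((x.isSome, none), v.2)) .halt))).seq
    ((realizable_drain .tmp [.var i] (by simp) (by simp) Polynomial.X).seq
      (realizable_drain .tmp' [.var j] (by simp) (by simp) Polynomial.X))).mono ?_
  rintro n _ _ ⟨s, _, ⟨hi, hj, rfl⟩, rfl, rfl⟩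
  refine ⟨_, ⟨_, ⟨s.flag, s.stk n, s.out, s.env i, s.env j, hi, rfl, rfl, rfl, rfl⟩,
    ?_⟩, _, ⟨decide (s.env i < s.env j), (update (update (update (update (s.stk n)
      (.var j) (List.replicate (s.env j - s.env i) true)) (.var i) [])
      .tmp (List.replicate (s.env i) true ++ s.stk n .tmp))
      .tmp' (List.replicate (min (s.env i) (s.env j)) true ++ s.stk n .tmp')), s.out, ?_, rfl, rfl⟩,
    ⟨decide (s.env i < s.env j), _, s.out, ?_, rfl, ?_⟩⟩
  · simp only [TM2.stepAux, mem, allStacks_inl, config]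
    congr 3
    by_cases h : s.env i < s.env j
    · obtain ⟨d, hd⟩ := Nat.exists_eq_add_of_lt h
      have : s.env j - s.env i = d + 1 := by omega
      simp [hji, h, this, List.replicate_succ]
    · have : s.env j - s.env i = 0 := by omega
      simp [hji, h, this]
  · simpa [State.stk] using hi
  · simp [State.stk, hi]
  · simp only [State.mem]
    congr 1
    funext k
    cases k with
    | var k =>
      by_cases h1 : k = i
      · subst h1; simp [State.stk, hij]
      · by_cases h2 : k = j
        · subst h2
          simp [State.stk, h1]
          omega
        · simp [State.stk, h1, h2]
    | _ => simp [State.stk]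

/-! #### Loops over the vertices -/

/-- Set a variable that is zero to the number of vertices. -/
theorem performs_fill (i : ι) :
    Performs A fun n s s' => s.env i = 0 ∧ s' = s.set i n := by
  refine ((realizable_drain .num [.tmp] (by simp) (by simp) Polynomial.X).seq
    (realizable_drain .tmp [.num, .var i] (by simp) (by simp) Polynomial.X)).mono ?_
  rintro n _ _ ⟨s, _, ⟨hi, rfl⟩, rfl, rfl⟩
  refine ⟨_, ⟨s.flag, s.stk n, s.out, by simp [State.stk], rfl, rfl⟩, s.flag, _, s.out, ?_, rfl, ?_⟩
  · simp [State.stk]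
  · simp only [State.mem]
    congr 1
    funext k
    cases k with
    | var k =>
      by_cases h1 : k = i
      · subst h1; simp [State.stk, hi]
      · simp [State.stk, h1]
    | _ => simp [State.stk]

/-- The loop over the vertices in descending order: `st a` is the state before the vertex `a - 1`
is treated. -/
theorem Performs.forLoop {R : ℕ → State ι → State ι → Prop} (i : ι) (hR : Performs A R) :
    Performs A fun n s s' => ∃ st : ℕ → State ι, (∀ a ≤ n, (st a).env i = 0) ∧ st n = s ∧
      st 0 = s' ∧ ∀ a < n, R n ((st (a + 1)).set i a) ((st a).set i a) := by
  refine (Realizable.seq (performs_fill i) (Realizable.loop (.inl (.var i)) toRegister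
    (fun v => v.1.2.isSome) Polynomial.X (Realizable.seq (realizable_single
      (clearRegister (ι := ι) (A := A))) hR))).mono ?_
  rintro n _ _ ⟨s, _, ⟨st, h0, rfl, rfl, h⟩, rfl, rfl⟩
  refine ⟨_, ⟨_, _, ⟨h0 n le_rfl, rfl⟩, rfl, rfl⟩, n, by simp, ?_⟩
  -- the loop is entered with `m` rounds to go
  suffices H : ∀ m ≤ n, ∀ R', (∀ s s' : State ι, R n s s' → ∀ r,
      R' (StackProgram.mem A s.flag r (s.stk n) s.out) (s'.mem A n)) →
      LoopRel (.inl (.var i)) toRegister (fun v : Var A => v.1.2.isSome) R' m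
        (((st m).set i m).mem A n) ((st 0).mem A n) by
    refine H n le_rfl _ fun s s' hs r => ⟨s.mem A n, rfl, s, s', hs, rfl, rfl⟩
  intro m hm R' hR'
  have hpop (s : State ι) (m : ℕ) : popped (.inl (.var i)) toRegister
      ((s.set i m).mem A n) = StackProgram.mem A s.flag (List.replicate m true).head?
        ((s.set i (m - 1)).stk n) s.out := by
    rw [State.mem, popped_mem]
    congr 1
    · simp [State.stk]
    · funext k
      cases k with
      | var k =>
        by_cases h1 : k = i
        · subst h1; simp [State.stk]
        · simp [State.stk, h1]
      | _ => simp [State.stk]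
  induction m with
  | zero =>
    have h' := LoopRel.done (k := (.inl (.var i) : Stk ι ⊕ A.tm.K)) (f := toRegister)
      (p := fun v : Var A => v.1.2.isSome) (s := ((st 0).set i 0).mem A n) (R := R')
      (by rw [hpop]; rfl)
    rw [hpop] at h'
    convert h' using 1
    rw [State.set_eq_self (h0 0 hm)]
    rfl
  | succ m ih =>
    refine .round (by rw [hpop]; rfl) ?_ (ih (by omega))
    rw [hpop]
    exact hR' _ _ (h m (by omega)) _

/-- A loop over the vertices that computes whether `P a` holds for some vertex `a`, where the body
computes `P a` and may have side effects: `st (a + 1)` is the state before `a` is treated, and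
`st a` the state thereafter. -/
theorem Performs.forAny {R : ℕ → State ι → State ι → Prop} (i : ι) (hR : Performs A R) :
    Performs A fun n s s' => ∃ (st : ℕ → State ι) (P : ℕ → Bool),
      (∀ a ≤ n, (st a).env i = 0) ∧ (∀ a ≤ n, (st a).acc = s.acc) ∧ s = st n ∧
      s' = { st 0 with flag := decide (∃ a < n, P a = true) } ∧
      ∀ a < n, ∀ l, R n { (st (a + 1)).set i a with acc := l, flag := false }
        { (st a).set i a with acc := l, flag := P a } := by
  refine ((performs_setFlag (fun _ => false)).seq (performs_saveFlag.seq
    ((((hR.seq performs_orFlag).seq (performs_setFlag (fun _ => false))).forLoop i).seq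
      performs_restoreFlag))).mono ?_
  rintro n _ _ ⟨st, P, henv, hacc, rfl, rfl, h⟩
  let ex (a : ℕ) : Bool := decide (∃ c < n, a ≤ c ∧ P c = true)
  refine ⟨_, rfl, _, rfl, { st 0 with flag := false, acc := ex 0 :: (st 0).acc },
    ⟨fun a => { st a with flag := false, acc := ex a :: (st n).acc }, henv, ?_, ?_, ?_⟩, ?_⟩
  · have : ex n = false := by simp [ex]; omega
    simp [this]
  · simp [hacc 0 (Nat.zero_le n)]
  · intro a ha
    refine ⟨_, ⟨_, h a ha (ex (a + 1) :: (st n).acc), _, _, rfl, rfl⟩, ?_⟩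
    have hex : ex a = (ex (a + 1) || P a) := by
      rw [Bool.eq_iff_iff, Bool.or_eq_true]
      simp only [ex, decide_eq_true_eq]
      constructor
      · rintro ⟨c, hc, hac, hP⟩
        rcases hac.eq_or_lt with rfl | hac
        · exact .inr hP
        · exact .inl ⟨c, hc, hac, hP⟩
      · rintro (⟨c, hc, hac, hP⟩ | hP)
        · exact ⟨c, hc, by omega, hP⟩
        · exact ⟨a, ha, le_rfl, hP⟩
    simp [State.set, hex]
  · refine ⟨_, _, rfl, ?_⟩
    simp [ex]

/-- A loop over the vertices in descending order whose body puts the word `w a` in front of the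
oracle input. -/
theorem Performs.forEmit {R : ℕ → State ι → State ι → Prop} (i : ι) (hR : Performs A R) :
    Performs A fun n s s' => s.env i = 0 ∧ ∃ w : ℕ → List Bool,
      s' = { s with flag := false, out := (List.range n).flatMap w ++ s.out } ∧
      ∀ a < n, ∀ o, R n { s.set i a with flag := false, out := o }
        { s.set i a with flag := false, out := w a ++ o } := by
  refine ((performs_setFlag (fun _ => false)).seq (hR.forLoop i)).mono ?_
  rintro n s _ ⟨henv, w, rfl, h⟩
  refine ⟨_, rfl, fun a => { s with
    flag := false, out := (List.range' a (n - a)).flatMap w ++ s.out }, fun a _ => henv, ?_, ?_, ?_⟩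
  · simp
  · simp [List.range_eq_range']
  · intro a ha
    have hr : List.range' a (n - a) = a :: List.range' (a + 1) (n - (a + 1)) := by
      rw [← List.range'_succ]
      congr 1
      omega
    simp only [hr, List.flatMap_cons, List.append_assoc]
    exact h a ha _

/-! ### Properties of graphs decided in polynomial time -/

/-- Adjacency of the vertices with the numbers `a` and `b`; it fails for numbers that are too
large. -/
def AdjNat {n : ℕ} (G : SimpleGraph (Fin n)) (a b : ℕ) : Prop :=
  ∃ (ha : a < n) (hb : b < n), G.Adj ⟨a, ha⟩ ⟨b, hb⟩

open Classical in
/-- An entry of the adjacency matrix. -/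
noncomputable def adjBit {n : ℕ} (G : SimpleGraph (Fin n)) (a b : ℕ) : Bool := decide (AdjNat G a b)

/-- The part of the adjacency matrix before the entry in row `a` and column `b`. -/
noncomputable def matrixBefore {n : ℕ} (G : SimpleGraph (Fin n)) (a b : ℕ) : List Bool :=
  (List.range a).flatMap (fun c => (List.range n).map (adjBit G c)) ++
    (List.range b).map (adjBit G a)

/-- The adjacency matrix, row by row. -/
noncomputable def matrixBits {n : ℕ} (G : SimpleGraph (Fin n)) : List Bool := matrixBefore G n 0

/-- The matrix stacks of the state represent the graph `G`, and no entry has been read. -/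
def State.Represents {n : ℕ} (s : State ι) (G : SimpleGraph (Fin n)) : Prop :=
  s.mat = (matrixBits G).reverse ∧ s.mat' = []

/-- A property of a graph on `Fin n`, values of variables and an oracle input. -/
abbrev Domain (ι : Type) : Type := ∀ n, SimpleGraph (Fin n) → (ι → ℕ) → List Bool → Prop

/-- The property `P` of a graph and of values of variables is decided in polynomial time by a
program with access to the oracle `A`, whenever the graph, the values of the variables and the
oracle input present at the start satisfy `D`. -/
def Decides (A : TM2ComputableAux Bool Bool) (D : Domain ι)
    (P : ∀ n, SimpleGraph (Fin n) → (ι → ℕ) → Prop) : Prop :=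
  Performs A fun n s s' => ∃ (G : SimpleGraph (Fin n)) (b : Bool), D n G s.env s.out ∧
    s.Represents G ∧ (b = true ↔ P n G s.env) ∧ s' = { s with flag := b }

namespace Decides

variable {D D' : Domain ι} {P P' : ∀ n, SimpleGraph (Fin n) → (ι → ℕ) → Prop}

theorem mono (h : Decides A D P) (hD : ∀ n G e o, D' n G e o → D n G e o)
    (hP : ∀ n G e o, D' n G e o → (P' n G e ↔ P n G e)) : Decides A D' P' :=
  Performs.mono h fun _ _ _ ⟨G, b, hs, hr, hb, hs'⟩ =>
    ⟨G, b, hD _ _ _ _ hs, hr, hb.trans (hP _ _ _ _ hs), hs'⟩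

/-- A proposition that depends neither on the graph nor on the variables is decided by a program
with its truth value built in. -/
theorem const (p : Prop) : Decides (ι := ι) A (fun _ _ _ _ => True) fun _ _ _ => p := by
  classical
  refine (performs_setFlag fun _ => decide p).mono ?_
  rintro n s _ ⟨G, b, -, -, hb, rfl⟩
  rw [Bool.eq_iff_iff.2 (hb.trans (decide_eq_true_iff (p := p)).symm)]

theorem not (h : Decides A D P) : Decides A D fun n G e => ¬ P n G e := by
  refine (Performs.seq h (performs_setFlag (!·))).mono ?_
  rintro n s _ ⟨G, b, hs, hr, hb, rfl⟩
  refine ⟨_, ⟨G, !b, hs, hr, ?_, rfl⟩, by simp⟩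
  cases b <;> simpa using hb

/-- Case distinction. Each case need only be decidable where it applies. -/
theorem ite {D₁ D₂ : Domain ι} {Q₁ Q₂ : ∀ n, SimpleGraph (Fin n) → (ι → ℕ) → Prop}
    (h : Decides A D P) (h₁ : Decides A D₁ Q₁) (h₂ : Decides A D₂ Q₂) :
    Decides A (fun n G e o => D n G e o ∧ (P n G e → D₁ n G e o) ∧ (¬ P n G e → D₂ n G e o))
      fun n G e => (P n G e ∧ Q₁ n G e) ∨ (¬ P n G e ∧ Q₂ n G e) := by
  classical
  refine (Performs.seq h (Performs.ite h₁ h₂)).mono ?_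
  rintro n s _ ⟨G, b, ⟨hD, hD₁, hD₂⟩, hr, hb, rfl⟩
  by_cases hP : P n G s.env
  · refine ⟨_, ⟨G, true, hD, hr, by simpa using hP, rfl⟩,
      .inl ⟨rfl, G, b, hD₁ hP, hr, ?_, rfl⟩⟩
    simpa [hP] using hb
  · refine ⟨_, ⟨G, false, hD, hr, by simpa using hP, rfl⟩,
      .inr ⟨rfl, G, b, hD₂ hP, hr, ?_, rfl⟩⟩
    simpa [hP] using hb

/-- Conjunction; the second property need only be decidable where the first one holds. -/
theorem and {Q : ∀ n, SimpleGraph (Fin n) → (ι → ℕ) → Prop}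
    (h : Decides A D P) (h' : Decides A D' Q) :
    Decides A (fun n G e o => D n G e o ∧ (P n G e → D' n G e o))
      fun n G e => P n G e ∧ Q n G e :=
  (h.ite h' (const False)).mono (fun _ _ _ _ h => ⟨h.1, h.2, fun _ => trivial⟩) (by simp)

theorem or {Q : ∀ n, SimpleGraph (Fin n) → (ι → ℕ) → Prop}
    (h : Decides A D P) (h' : Decides A D' Q) :
    Decides A (fun n G e o => D n G e o ∧ D' n G e o) fun n G e => P n G e ∨ Q n G e :=
  (h.ite (const True) h').mono (fun _ _ _ _ h => ⟨h.1, fun _ => trivial, fun _ => h.2⟩)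
    (by intros; tauto)

theorem finExists {W : Type} [Finite W] {P : W → ∀ n, SimpleGraph (Fin n) → (ι → ℕ) → Prop}
    (h : ∀ w, Decides A D (P w)) : Decides A D fun n G e => ∃ w, P w n G e := by
  classical
  have := Fintype.ofFinite W
  suffices H : ∀ s : Finset W, Decides A D fun n G e => ∃ w ∈ s, P w n G e by simpa using H .univ
  intro s
  induction s using Finset.induction with
  | empty => exact (const False).mono (by simp) (by simp)
  | insert w s _ ih => exact ((h w).or ih).mono (by simp) (by simp)

theorem finForall {W : Type} [Finite W] {P : W → ∀ n, SimpleGraph (Fin n) → (ι → ℕ) → Prop}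
    (h : ∀ w, Decides A D (P w)) : Decides A D fun n G e => ∀ w, P w n G e :=
  (finExists fun w => (h w).not).not.mono (fun _ _ _ _ h => h) (by simp)

/-- Existential quantification over the vertices, with the bound variable `i`. -/
theorem bex (i : ι) (h : Decides A D P) :
    Decides A (fun n G e o => e i = 0 ∧ ∀ a < n, D n G (update e i a) o)
      fun n G e => ∃ a < n, P n G (update e i a) := by
  classical
  refine (Performs.forAny i h).mono ?_
  rintro n s _ ⟨G, b, ⟨hi, hD⟩, hr, hb, rfl⟩
  refine ⟨fun _ => s, fun a => decide (P n G (update s.env i a)), fun _ _ => hi, fun _ _ => rfl,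
    rfl, ?_, fun a ha l => ⟨G, _, hD a ha, hr, by simp; rfl, rfl⟩⟩
  congr 1
  rw [Bool.eq_iff_iff, hb]
  simp

theorem lt {i j : ι} (hij : i ≠ j) :
    Decides A (fun n _ e _ => e i ≤ n ∧ e j ≤ n) fun _ _ e => e i < e j := by
  refine (performs_lt hij).mono ?_
  rintro n s _ ⟨G, b, ⟨hi, hj⟩, -, hb, rfl⟩
  refine ⟨hi, hj, ?_⟩
  rw [Bool.eq_iff_iff.2 (hb.trans decide_eq_true_iff.symm)]

theorem eq {i j : ι} (hij : i ≠ j) :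
    Decides A (fun n _ e _ => e i ≤ n ∧ e j ≤ n) fun _ _ e => e i = e j :=
  ((lt hij).not.and (lt hij.symm).not).mono (by intros; tauto) (by intros; omega)

end Decides

namespace Decides

variable {D D' : Domain ι} {P P' : ∀ n, SimpleGraph (Fin n) → (ι → ℕ) → Prop}

/-- Existential quantification over the values of all variables in the set `s`. -/
theorem bexSet (s : Finset ι) (h : Decides A D P) :
    Decides A
      (fun n G e o => (∀ i ∈ s, e i = 0) ∧
        ∀ e' : ι → ℕ, (∀ i ∈ s, e' i < n) → (∀ i ∉ s, e' i = e i) → D n G e' o)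
      fun n G e => ∃ e' : ι → ℕ, (∀ i ∈ s, e' i < n) ∧ (∀ i ∉ s, e' i = e i) ∧ P n G e' := by
  induction s using Finset.induction with
  | empty =>
    have he (e e' : ι → ℕ) : (∀ i ∉ (∅ : Finset ι), e' i = e i) ↔ e' = e := by
      simp [funext_iff]
    refine h.mono (fun n G e o hD => hD.2 e (by simp) (by simp)) fun n G e o _ => ?_
    simp only [he]
    simp
  | insert i s hi ih =>
    refine (bex i ih).mono ?_ ?_
    · rintro n G e o ⟨h0, hD⟩
      refine ⟨h0 i (by simp), fun a ha => ⟨fun j hj => ?_, fun e' he' hs => hD e' ?_ ?_⟩⟩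
      · rw [update_of_ne (by rintro rfl; exact hi hj)]
        exact h0 j (by simp [hj])
      · intro j hj
        rcases Finset.mem_insert.1 hj with rfl | hj
        · rw [hs _ hi, update_self]; exact ha
        · exact he' j hj
      · intro j hj
        rw [Finset.mem_insert, not_or] at hj
        rw [hs j hj.2, update_of_ne hj.1]
    · rintro n G e o -
      constructor
      · rintro ⟨e', he', hs, hP⟩
        refine ⟨e' i, he' i (by simp), e', fun j hj => he' j (by simp [hj]), fun j hj => ?_, hP⟩
        by_cases hji : j = i
        · subst hji; simp
        · rw [update_of_ne hji]; exact hs j (by simp [hji, hj])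
      · rintro ⟨a, ha, e', he', hs, hP⟩
        refine ⟨e', fun j hj => ?_, fun j hj => ?_, hP⟩
        · rcases Finset.mem_insert.1 hj with rfl | hj
          · rw [hs _ hi, update_self]; exact ha
          · exact he' j hj
        · rw [Finset.mem_insert, not_or] at hj
          rw [hs j hj.2, update_of_ne hj.1]

/-- Universal quantification over the vertices, with the bound variable `i`. -/
theorem ball (i : ι) (h : Decides A D P) :
    Decides A (fun n G e o => e i = 0 ∧ ∀ a < n, D n G (update e i a) o)
      fun n G e => ∀ a < n, P n G (update e i a) :=
  (bex i h.not).not.mono (fun _ _ _ _ h => h) (by simp)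

end Decides

/-! #### Looking up an entry of the adjacency matrix -/

theorem performs_eq {i j : ι} (hij : i ≠ j) :
    Performs A fun n s s' => s.env i ≤ n ∧ s.env j ≤ n ∧
      s' = { s with flag := decide (s.env i = s.env j) } := by
  refine ((performs_lt hij).seq ((performs_setFlag fun _ => false).ite
    ((performs_lt hij.symm).seq (performs_setFlag (!·))))).mono ?_
  rintro n s _ ⟨hi, hj, rfl⟩
  refine ⟨_, ⟨hi, hj, rfl⟩, ?_⟩
  by_cases h : s.env i < s.env j
  · exact .inl ⟨by simpa using h, by simp [h.ne]⟩
  · refine .inr ⟨by simpa using h, _, ⟨hj, hi, rfl⟩, ?_⟩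
    simp only [State.mk.injEq, and_self, and_true]
    rw [Bool.eq_iff_iff]
    simp
    omega

theorem matrixBefore_succ {n : ℕ} (G : SimpleGraph (Fin n)) (a b : ℕ) :
    matrixBefore G a (b + 1) = matrixBefore G a b ++ [adjBit G a b] := by
  simp [matrixBefore, List.range_succ]

theorem matrixBefore_last {n : ℕ} (G : SimpleGraph (Fin n)) (a : ℕ) :
    matrixBefore G a n = matrixBefore G (a + 1) 0 := by
  simp [matrixBefore, List.range_succ]

theorem matrixBefore_prefix {n : ℕ} (G : SimpleGraph (Fin n)) {a b : ℕ} (ha : a < n)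
    (hb : b ≤ n) : matrixBefore G a b <+: matrixBits G := by
  have h₁ : matrixBefore G a b <+: matrixBefore G a n := by
    obtain ⟨c, rfl⟩ := Nat.exists_eq_add_of_le hb
    rw [matrixBefore, matrixBefore, List.range_add (n := b), List.map_append,
      ← List.append_assoc]
    exact List.prefix_append _ _
  refine h₁.trans ?_
  obtain ⟨c, hc⟩ := Nat.exists_eq_add_of_le (Nat.succ_le_of_lt ha)
  rw [matrixBefore_last, matrixBits, matrixBefore, matrixBefore]
  simp only [List.range_zero, List.map_nil, List.append_nil]
  generalize hf : (fun c => List.map (adjBit G c) (List.range n)) = f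
  have : List.range n = List.range (a + 1) ++ (List.range c).map (a + 1 + ·) := by
    rw [← List.range_add, ← Nat.succ_eq_add_one, ← hc]
  rw [this, List.flatMap_append]
  exact List.prefix_append _ _

/-- The part of the adjacency matrix from the entry in row `a` and column `b` on. -/
noncomputable def matrixFrom {n : ℕ} (G : SimpleGraph (Fin n)) (a b : ℕ) : List Bool :=
  (matrixBits G).drop (matrixBefore G a b).length

theorem matrixFrom_eq_cons {n : ℕ} (G : SimpleGraph (Fin n)) {a b : ℕ} (ha : a < n)
    (hb : b < n) : matrixFrom G a b = adjBit G a b :: matrixFrom G a (b + 1) := by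
  obtain ⟨t, ht⟩ := matrixBefore_prefix G ha (Nat.succ_le_of_lt hb)
  rw [matrixFrom, matrixFrom, ← ht, List.drop_left, Nat.succ_eq_add_one, matrixBefore_succ,
    List.append_assoc, List.drop_left]
  rfl

theorem length_matrixBits {n : ℕ} (G : SimpleGraph (Fin n)) : (matrixBits G).length = n * n := by
  simp [matrixBits, matrixBefore]

/-- The entry `(i, j)` is found by reading the matrix entry by entry, with `x` and `y` running over
the rows and columns. -/
theorem Decides.adj {i j x y : ι} (hxi : x ≠ i) (hyj : y ≠ j) (hxy : x ≠ y) (hyi : y ≠ i)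
    (hxj : x ≠ j) :
    Decides A (fun n _ e _ => e i < n ∧ e j < n ∧ e x = 0 ∧ e y = 0)
      fun _ G e => AdjNat G (e i) (e j) := by
  have body := (((performs_eq (A := A) hxi).seq
    ((performs_eq hyj).ite (performs_setFlag id))).seq performs_readBit)
  refine (((body.forAny y).forAny x).seq ((performs_rewind
    (Polynomial.X * Polynomial.X)).seq (performs_setFlag id))).mono ?_
  rintro n s _ ⟨G, b, ⟨hi, hj, hx, hy⟩, ⟨hm, hm'⟩, hb, rfl⟩
  let P (a c : ℕ) : Bool := decide (a = s.env i) && decide (c = s.env j) && adjBit G a c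
  refine ⟨{ s with flag := b, mat := [], mat' := matrixBits G },
    ⟨fun a => { s with mat := (matrixBefore G a 0).reverse, mat' := matrixFrom G a 0 },
      fun a => decide (∃ c < n, P a c = true), fun _ _ => hx, fun _ _ => rfl, ?_, ?_, ?_⟩,
      _, ⟨by simp [length_matrixBits], rfl⟩, ?_⟩
  · have h1 : matrixBefore G n 0 = matrixBits G := rfl
    have h2 : matrixFrom G n 0 = [] := by simp [matrixFrom, h1]
    simp [h1, h2, ← hm, ← hm']
  · have h1 : matrixBefore G 0 0 = [] := by simp [matrixBefore]
    have h2 : matrixFrom G 0 0 = matrixBits G := by simp [matrixFrom, h1]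
    simp only [h1, h2, List.reverse_nil, State.mk.injEq, and_self, and_true]
    have hP (a c : ℕ) : P a c = true ↔ (a = s.env i ∧ c = s.env j) ∧ AdjNat G a c := by
      simp only [P, adjBit, Bool.and_eq_true, decide_eq_true_eq]
    rw [Bool.eq_iff_iff, hb]
    simp only [decide_eq_true_eq, hP]
    constructor
    · exact fun h => ⟨_, hi, _, hj, ⟨rfl, rfl⟩, h⟩
    · rintro ⟨a, -, c, -, ⟨rfl, rfl⟩, h⟩; exact h
  · intro a ha l
    refine ⟨fun c => { s.set x a with
      flag := false, acc := l, mat := (matrixBefore G a c).reverse, mat' := matrixFrom G a c },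
      P a, fun _ _ => ?_, fun _ _ => rfl, ?_, ?_, ?_⟩
    · simp [hxy.symm, hy]
    · simp only [matrixBefore_last, State.set, State.mk.injEq, true_and]
      rw [matrixFrom, matrixFrom, matrixBefore_last]
    · rfl
    · intro c hc l'
      refine ⟨{ ((s.set x a).set y c) with
        flag := decide (a = s.env i) && decide (c = s.env j), acc := l',
        mat := (matrixBefore G a (c + 1)).reverse, mat' := matrixFrom G a (c + 1) },
        ⟨_, ⟨?_, ?_, rfl⟩, ?_⟩, adjBit G a c, (matrixBefore G a c).reverse, ?_, ?_⟩
      · simpa [hxy] using ha.le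
      · simpa [hxi.symm, hyi.symm] using hi.le
      · by_cases h : a = s.env i
        · refine .inl ⟨by simp [hxy, hxi.symm, hyi.symm, h], ?_, ?_, ?_⟩
          · simpa using hc.le
          · simpa [hxj.symm, hyj.symm] using hj.le
          · simp [State.set, h, hxj.symm, hyj.symm]
        · refine .inr ⟨by simp [hxy, hxi.symm, hyi.symm, h], ?_⟩
          simp [State.set, hxy, hxi.symm, hyi.symm, h]
      · simp [matrixBefore_succ]
      · simp [State.set, matrixFrom_eq_cons G ha hc, P]
  · simp [hm, hm']

/-! ### Preparing the oracle input -/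

/-- The word `w`, which depends on a graph and values of variables, is put in front of the oracle
input in polynomial time, whenever the graph and the values of the variables satisfy `D`. -/
def Emits (A : TM2ComputableAux Bool Bool) (D : ∀ n, SimpleGraph (Fin n) → (ι → ℕ) → Prop)
    (w : ∀ n, SimpleGraph (Fin n) → (ι → ℕ) → List Bool) : Prop :=
  Performs A fun n s s' => ∃ G : SimpleGraph (Fin n), D n G s.env ∧ s.Represents G ∧
    s' = { s with flag := false, out := w n G s.env ++ s.out }

namespace Emits

variable {D D' P : ∀ n, SimpleGraph (Fin n) → (ι → ℕ) → Prop}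
  {w w' : ∀ n, SimpleGraph (Fin n) → (ι → ℕ) → List Bool}

theorem mono (h : Emits A D w) (hD : ∀ n G e, D' n G e → D n G e)
    (hw : ∀ n G e, D' n G e → w n G e = w' n G e) : Emits A D' w' :=
  Performs.mono h fun _ _ _ ⟨G, hs, hr, hs'⟩ => ⟨G, hD _ _ _ hs, hr, by rw [hw _ _ _ hs, hs']⟩

theorem bit (c : Bool) : Emits (ι := ι) A (fun _ _ _ => True) fun _ _ _ => [c] :=
  (performs_emit fun _ => c).mono fun _ _ _ ⟨_, _, _, h⟩ => h

open Classical in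
theorem truthValue (h : Decides A (fun n G e _ => D n G e) P) :
    Emits A D fun n G e => [decide (P n G e)] := by
  refine (Performs.seq h (performs_emit id)).mono ?_
  rintro n s _ ⟨G, hD, hr, rfl⟩
  exact ⟨_, ⟨G, decide (P n G s.env), hD, hr, by simp, rfl⟩, rfl⟩

theorem append (h : Emits A D w) (h' : Emits A D' w') :
    Emits A (fun n G e => D n G e ∧ D' n G e) fun n G e => w n G e ++ w' n G e := by
  refine (Performs.seq h' h).mono ?_
  rintro n s _ ⟨G, ⟨hD, hD'⟩, hr, rfl⟩
  exact ⟨_, ⟨G, hD', hr, rfl⟩, G, hD, hr, by simp⟩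

open Classical in
theorem guard (h : Decides A (fun n G e _ => D n G e) P) (h' : Emits A D' w) :
    Emits A (fun n G e => D n G e ∧ (P n G e → D' n G e))
      fun n G e => if P n G e then w n G e else [] := by
  refine (Performs.seq h (Performs.ite h' (performs_setFlag id))).mono ?_
  rintro n s _ ⟨G, ⟨hD, hD'⟩, hr, rfl⟩
  refine ⟨_, ⟨G, decide (P n G s.env), hD, hr, by simp, rfl⟩, ?_⟩
  by_cases hP : P n G s.env
  · exact .inl ⟨by simpa using hP, G, hD' hP, hr, by simp [hP]⟩
  · exact .inr ⟨by simpa using hP, by simp [hP]⟩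

theorem loop (i : ι) (h : Emits A D w) :
    Emits A (fun n G e => e i = 0 ∧ ∀ a < n, D n G (update e i a))
      fun n G e => (List.range n).flatMap fun a => w n G (update e i a) := by
  refine (Performs.forEmit i h).mono ?_
  rintro n s _ ⟨G, ⟨hi, hD⟩, hr, rfl⟩
  exact ⟨hi, fun a => w n G (update s.env i a), rfl, fun a ha o => ⟨G, hD a ha, hr, rfl⟩⟩

end Emits

/-- The answer of the oracle on an input that can be prepared in polynomial time. Nothing is asked
of inputs on which the oracle does not answer in time. -/
theorem Decides.oracle {D P : ∀ n, SimpleGraph (Fin n) → (ι → ℕ) → Prop}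
    {w : ∀ n, SimpleGraph (Fin n) → (ι → ℕ) → List Bool} (h : Emits A D w) (B : Polynomial ℕ) :
    Decides A (fun n G e o => D n G e ∧ o = [] ∧ ∃ c : Bool,
      Nonempty (TM2OutputsInTime A.tm ((w n G e).map A.inputAlphabet.invFun)
        (some ([c].map A.outputAlphabet.invFun)) (B.eval n)) ∧ (c = true ↔ P n G e)) P := by
  refine (Performs.seq h (performs_oracle B)).mono ?_
  rintro n s _ ⟨G, b, ⟨hD, ho, c, hc, hP⟩, hr, hb, rfl⟩
  obtain rfl : b = c := Bool.eq_iff_iff.2 (hb.trans hP.symm)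
  exact ⟨_, ⟨G, hD, hr, rfl⟩, b, by simpa [ho] using hc, by simp [ho]⟩

/-! ### From programs to machines that decide graph problems -/

theorem flatMap_range_eq_flatten_ofFn {β : Type} (n : ℕ) (f : ℕ → List β) :
    (List.range n).flatMap f = (List.ofFn fun i : Fin n => f i).flatten := by
  rw [List.flatMap, ← List.map_coe_finRange_eq_range, List.map_map, List.ofFn_eq_map]
  rfl

theorem encodeGraph_eq {n : ℕ} (G : SimpleGraph (Fin n)) :
    encodeGraph ⟨n, G⟩ = List.replicate n true ++ false :: matrixBits G := by
  simp [encodeGraph, encodeUnary, matrixBits, matrixBefore, flatMap_range_eq_flatten_ofFn]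
  congr 2
  funext i
  rw [← List.map_coe_finRange_eq_range, List.map_map, List.ofFn_eq_map]
  congr 1
  funext j
  rw [Function.comp_apply, adjBit, decide_eq_decide]
  exact ⟨fun h => ⟨i.2, j.2, h⟩, fun ⟨_, _, h⟩ => h⟩

/-- The work stacks at the start and at the end of a computation. -/
def ioStacks (l : List Bool) : Stk ι → List Bool
  | .inp => l
  | _ => []

/-- The encoded graph is taken apart into the number of vertices and the adjacency matrix. -/
theorem realizable_parse :
    Realizable fun n (s s' : Memory (Alphabet ι A) (Var A)) => ∃ G : SimpleGraph (Fin n),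
      s = mem A false none (ioStacks (encodeGraph ⟨n, G⟩)) [] ∧
      s' = (⟨false, fun _ => 0, [], [], (matrixBits G).reverse, []⟩ : State ι).mem A n := by
  refine (((realizable_single (Γ := Alphabet ι A) (σ := Var A) (.push (.inl .num) (fun _ => true)
    clearRegister)).loop (.inl .inp) toRegister (fun v => v.1.2 == some true) Polynomial.X).seq
    ((realizable_single clearRegister).seq (realizable_drain .inp [.mat] (by simp) (by simp)
      (Polynomial.X * Polynomial.X)))).mono ?_
  rintro n _ _ ⟨G, rfl, rfl⟩
  let S (k m : ℕ) (x : List Bool) : Stk ι → List Bool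
    | .inp => List.replicate k true ++ x
    | .num => List.replicate m true
    | _ => []
  have hS (k m : ℕ) (x : List Bool) (b : Bool) (hx : (List.replicate k true ++ x).head? = some b) :
      popped (.inl .inp) toRegister (mem A false none (S k m x) []) =
        mem A false (some b) (update (S k m x) .inp (List.replicate k true ++ x).tail) [] := by
    rw [popped_mem]
    congr 1
  refine ⟨mem A false (some false) (S 0 n (matrixBits G)) [], ⟨n, by simp, ?_⟩,
    mem A false none (S 0 n (matrixBits G)) [], rfl, false, S 0 n (matrixBits G), [], ?_, rfl, ?_⟩
  · have H : ∀ k m, k + m = n → LoopRel (.inl .inp) toRegister (fun v : Var A => v.1.2 == some true)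
        (fun s s' => TM2.stepAux (.push (.inl .num) (fun _ => true) clearRegister) s.1 s.2 =
          config none s') k (mem A false none (S k m (false :: matrixBits G)) [])
        (mem A false (some false) (S 0 n (matrixBits G)) []) := by
      intro k
      induction k with
      | zero =>
        intro m hm
        obtain rfl : m = n := by omega
        have h := LoopRel.done (k := (.inl .inp : Stk ι ⊕ A.tm.K)) (f := toRegister)
          (p := fun v : Var A => v.1.2 == some true)
          (s := mem A false none (S 0 m (false :: matrixBits G)) [])
          (R := fun s s' => TM2.stepAux (.push (.inl .num) (fun _ => true) clearRegister) s.1 s.2 =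
            config none s') (by rw [hS _ _ _ false rfl]; rfl)
        rw [hS _ _ _ false rfl] at h
        convert h using 2
        funext k
        cases k <;> simp [S]
      | succ k ih =>
        intro m hm
        refine .round (by rw [hS _ _ _ true rfl]; rfl) ?_ (ih (m + 1) (by omega))
        rw [hS _ _ _ true rfl]
        simp only [TM2.stepAux, mem, config, allStacks_inl, update_allStacks_inl, clearRegister]
        congr 2
        funext k
        cases k <;> simp [S, List.replicate_succ]
    convert H n 0 rfl using 2
    funext k
    cases k <;> simp [ioStacks, S, encodeGraph_eq]
  · simp [S, length_matrixBits]
  · simp only [State.mem]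
    congr 1
    funext k
    cases k <;> simp [State.stk, S]

/-- In the end all stacks are emptied, the truth value is put out, and the flag is reset, since a
machine has to halt in its initial internal state with nothing but its output on the stacks. -/
theorem realizable_output :
    Realizable fun n (s s' : Memory (Alphabet ι A) (Var A)) =>
      ∃ (G : SimpleGraph (Fin n)) (b : Bool),
      s = (⟨b, fun _ => 0, [], [], (matrixBits G).reverse, []⟩ : State ι).mem A n ∧
      s' = mem A false none (ioStacks [b]) [] := by
  refine (((realizable_drain .num [] (by simp) (by simp) Polynomial.X).seq
    (realizable_drain .mat [] (by simp) (by simp) (Polynomial.X * Polynomial.X))).seq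
    (realizable_single (.push (.inl .inp) (fun v => v.1.1)
      (.load (fun v => ((false, none), v.2)) .halt)))).mono ?_
  rintro n _ _ ⟨G, b, rfl, rfl⟩
  refine ⟨_, ⟨_, ⟨b, _, _, ?_, rfl, rfl⟩, b, _, _, ?_, rfl, rfl⟩, ?_⟩
  · simp [State.stk]
  · simp [State.stk, length_matrixBits]
  · simp only [TM2.stepAux, mem, config, allStacks_inl, update_allStacks_inl]
    congr 2
    funext k
    cases k <;> simp [State.stk, ioStacks]

/-- The machine that runs the fragment `F`, with input and output on the stack `inp`. -/
def toMachine [Fintype ι] (F : Fragment (Alphabet ι A) (Var A)) : FinTM2 where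
  K := Stk ι ⊕ A.tm.K
  kFin := letI := A.tm.kFin; inferInstance
  k₀ := .inl .inp
  k₁ := .inl .inp
  Γ := Alphabet ι A
  Λ := F.Label
  main := F.entry
  ΛFin := F.fintype
  σ := Var A
  initialState := ((false, none), A.tm.initialState)
  σFin := letI := A.tm.σFin; inferInstance
  Γk₀Fin := inferInstanceAs (Fintype Bool)
  m := F.code

theorem initList_toMachine [Fintype ι] (F : Fragment (Alphabet ι A) (Var A)) (l : List Bool) :
    initList (toMachine F) l =
      (⟨some F.entry, ((false, none), A.tm.initialState), allStacks (ioStacks l) fun _ => []⟩ :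
        TM2.Cfg (Alphabet ι A) F.Label (Var A)) := by
  refine congrArg (TM2.Cfg.mk _ _) (funext fun k => ?_)
  rcases k with k | k
  · cases k <;> rfl
  · rfl

theorem haltList_toMachine [Fintype ι] (F : Fragment (Alphabet ι A) (Var A)) (l : List Bool) :
    haltList (toMachine F) l =
      (⟨none, ((false, none), A.tm.initialState), allStacks (ioStacks l) fun _ => []⟩ :
        TM2.Cfg (Alphabet ι A) F.Label (Var A)) := by
  refine congrArg (TM2.Cfg.mk _ _) (funext fun k => ?_)
  rcases k with k | k
  · cases k <;> rfl
  · rfl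

theorem oracleInput_nil (k : A.tm.K) : oracleInput A [] k = [] := by
  by_cases hk : k = A.tm.k₀
  · subst hk; simp [oracleInput, initList]
  · simp [oracleInput, initList, hk]

/-- A graph problem is solved in polynomial time on a class by a program that is correct on the
graphs of the class. -/
theorem Decides.polyTimeDecidable [Fintype ι] {D : Domain ι}
    {P : ∀ n, SimpleGraph (Fin n) → (ι → ℕ) → Prop} (h : Decides A D P) {C : GraphClass}
    {Q : C.Instance → Prop}
    (hD : ∀ (n : ℕ) (G : SimpleGraph (Fin n)), C.Mem G → D n G (fun _ => 0) [])
    (hP : ∀ x : C.Instance, Q x ↔ P x.1.1 x.1.2 fun _ => 0) :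
    PolyTimeDecidable (fun x : C.Instance => encodeGraph x.1) Q := by
  classical
  obtain ⟨F, p, hF⟩ := realizable_parse.seq (Realizable.seq h realizable_output)
  refine ⟨⟨⟨toMachine F, Equiv.refl _, Equiv.refl _⟩, p, fun x => ?_⟩⟩
  obtain ⟨⟨n, G⟩, hx⟩ := x
  have hrun := hF n (mem A false none (ioStacks (encodeGraph ⟨n, G⟩)) [])
    (mem A false none (ioStacks [decide (Q ⟨⟨n, G⟩, hx⟩)]) [])
    ⟨_, ⟨G, rfl, rfl⟩, _, ⟨_, _, ⟨G, decide (Q ⟨⟨n, G⟩, hx⟩), hD n G hx, ⟨rfl, rfl⟩,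
      by simpa using hP ⟨⟨n, G⟩, hx⟩, rfl⟩, rfl, rfl⟩, G, _, rfl, rfl⟩
  have hex : ∃ t ≤ p.eval (encodeGraph ⟨n, G⟩).length,
      F.Runs t (mem A false none (ioStacks (encodeGraph ⟨n, G⟩)) [])
        (mem A false none (ioStacks [decide (Q ⟨⟨n, G⟩, hx⟩)]) []) := by
    obtain ⟨t, ht, hr⟩ := hrun
    exact ⟨t, ht.trans (eval_mono p (by simp [encodeGraph_eq])), hr⟩
  have hconf (l : List Bool) (o : Option F.Label) :
      config o (mem A false none (ioStacks l) []) =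
        (⟨o, ((false, none), A.tm.initialState),
          allStacks (ioStacks l) fun _ => []⟩ : TM2.Cfg (Alphabet ι A) F.Label (Var A)) := by
    simp [config, mem, funext oracleInput_nil]
  refine ⟨⟨hex.choose, ?_⟩, hex.choose_spec.1⟩
  have hit := hex.choose_spec.2.iterate
  rw [hconf, hconf, ← initList_toMachine, ← haltList_toMachine] at hit
  exact (congrArg (fun l => (flip bind (TM2.step F.code))^[hex.choose]
    (some (initList (toMachine F) l))) (List.map_id (encodeGraph ⟨n, G⟩))).trans hit

end Programs

end StackProgram

namespace TotalDomination

/-! ### Total domination and edge contraction -/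

/-- The graph `G` has a total dominating set of size at most `k`. -/
def HasTotalDominatingSet {V : Type} (G : SimpleGraph V) (k : ℕ) : Prop :=
  ∃ D : Finset V, IsTotalDominatingSet G D ∧ D.card ≤ k

section

variable {V W : Type} {G : SimpleGraph V}

theorem totalDominationNumber_le_iff {k : ℕ} :
    totalDominationNumber G ≤ k ↔ HasTotalDominatingSet G k := by
  constructor
  · intro h
    by_contra hk
    have : ((k + 1 : ℕ) : ℕ∞) ≤ totalDominationNumber G := by
      refine le_iInf₂ fun D hD => ?_
      by_contra hc
      exact hk ⟨D, hD, by rw [Nat.cast_le] at hc; omega⟩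
    have := this.trans h
    rw [Nat.cast_le] at this
    omega
  · rintro ⟨D, hD, hc⟩
    exact (iInf₂_le D hD).trans (by exact_mod_cast hc)

theorem HasTotalDominatingSet.mono {k l : ℕ} (h : HasTotalDominatingSet G k) (hkl : k ≤ l) :
    HasTotalDominatingSet G l := h.imp fun _ h => ⟨h.1, h.2.trans hkl⟩

theorem HasTotalDominatingSet.of_iso {G' : SimpleGraph W} {k : ℕ} (e : G ≃g G')
    (h : HasTotalDominatingSet G k) : HasTotalDominatingSet G' k := by
  obtain ⟨D, hD, hk⟩ := h
  refine ⟨D.map e.toEquiv.toEmbedding, fun w => ?_, by simpa using hk⟩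
  obtain ⟨x, hx, hadj⟩ := hD (e.symm w)
  exact ⟨e x, Finset.mem_map_of_mem _ hx, by rw [← e.map_adj_iff] at hadj; simpa using hadj⟩

theorem hasTotalDominatingSet_congr {G' : SimpleGraph W} {k : ℕ} (e : G ≃g G') :
    HasTotalDominatingSet G k ↔ HasTotalDominatingSet G' k :=
  ⟨.of_iso e, .of_iso e.symm⟩

/-- Total dominating sets of size at most `k` as families indexed by a set `J` of size `k`. -/
theorem hasTotalDominatingSet_iff_family [Nonempty V] {X : Type} (J : Finset X) :
    HasTotalDominatingSet G J.card ↔ ∃ f : X → V, ∀ y, ∃ j ∈ J, G.Adj y (f j) := by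
  classical
  constructor
  · rintro ⟨D, hD, hk⟩
    obtain ⟨v⟩ := ‹Nonempty V›
    obtain ⟨w, hw, -⟩ := hD v
    have : Nonempty D := ⟨⟨w, hw⟩⟩
    obtain ⟨g⟩ : Nonempty (D ↪ J) := by
      rw [Function.Embedding.nonempty_iff_card_le]
      simpa using hk
    refine ⟨fun x => if hx : x ∈ J then (Function.invFun g ⟨x, hx⟩ : D) else v, fun y => ?_⟩
    obtain ⟨x, hx, hadj⟩ := hD y
    refine ⟨g ⟨x, hx⟩, (g ⟨x, hx⟩).2, ?_⟩
    simpa [Function.leftInverse_invFun g.injective ⟨x, hx⟩] using hadj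
  · rintro ⟨f, hf⟩
    refine ⟨J.image f, fun y => ?_, Finset.card_image_le⟩
    obtain ⟨j, hj, hadj⟩ := hf y
    exact ⟨f j, Finset.mem_image_of_mem f hj, hadj⟩

theorem hasTotalDominatingSet_card [Fintype V] (hG : G.Connected) {u v : V} (huv : G.Adj u v) :
    HasTotalDominatingSet G (Fintype.card V) := by
  have : Nontrivial V := ⟨u, v, huv.ne⟩
  exact ⟨Finset.univ, fun w => (hG.preconnected.exists_adj_of_nontrivial w).imp
    fun x hx => ⟨Finset.mem_univ x, hx⟩, le_rfl⟩

/-- A contraction lowers the total domination number if some number separates it from the old one.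
Connectedness matters here: if `γ_t` were infinite before and after the contraction, it would
count as lowered. -/
theorem hasReducingContraction_iff [Finite V] (hG : G.Connected) :
    HasReducingContraction G ↔ ∃ u v, G.Adj u v ∧
      ∃ k, HasTotalDominatingSet (contractEdge G u v) k ∧ ¬ HasTotalDominatingSet G k := by
  have := Fintype.ofFinite V
  refine exists_congr fun u => exists_congr fun v => and_congr_right fun huv => ?_
  have htop : totalDominationNumber G ≠ ⊤ :=
    ((totalDominationNumber_le_iff.2 (hasTotalDominatingSet_card hG huv)).trans_lt
      (ENat.natCast_lt_top _)).ne
  simp only [← totalDominationNumber_le_iff]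
  generalize totalDominationNumber G = b at htop
  generalize totalDominationNumber (contractEdge G u v) = a
  obtain ⟨b, rfl⟩ := ENat.ne_top_iff_exists.1 htop
  constructor
  · intro h
    have ha : a ≠ ⊤ := by rintro rfl; simp at h
    obtain ⟨a, rfl⟩ := ENat.ne_top_iff_exists.1 ha
    have h : a + 1 ≤ b := by exact_mod_cast h
    exact ⟨a, le_rfl, by rw [Nat.cast_le]; omega⟩
  · rintro ⟨k, ha, hb⟩
    refine (add_le_add_left ha 1).trans ?_
    rw [Nat.cast_le] at hb
    exact_mod_cast Nat.succ_le_of_lt (not_le.1 hb)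

/-! #### The contracted graph on the old vertices -/

/-- The graph `G / uv` with `u` as the merged vertex; `v` is kept as an isolated vertex. -/
def mergeGraph (G : SimpleGraph V) (u v : V) : SimpleGraph V where
  Adj x y := x ≠ v ∧ y ≠ v ∧ x ≠ y ∧ (G.Adj x y ∨ x = u ∧ G.Adj v y ∨ y = u ∧ G.Adj x v)
  symm := ⟨fun x y ⟨hx, hy, hxy, h⟩ => ⟨hy, hx, hxy.symm, by
    rcases h with h | h | h
    · exact .inl h.symm
    · exact .inr (.inr ⟨h.1, h.2.symm⟩)
    · exact .inr (.inl ⟨h.1, h.2.symm⟩)⟩⟩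
  loopless := ⟨fun _ h => h.2.2.1 rfl⟩

open Classical in
/-- Contracting `uv` amounts to merging `v` into `u` and deleting `v`. -/
noncomputable def contractEdgeIso (G : SimpleGraph V) {u v : V} (huv : u ≠ v) :
    contractEdge G u v ≃g (mergeGraph G u v).induce {x | x ≠ v} where
  toFun
    | none => ⟨u, huv⟩
    | some w => ⟨w, w.2.2⟩
  invFun x := if hx : (x : V) = u then none else some ⟨x, hx, x.2⟩
  left_inv := by
    rintro (_ | w)
    · simp
    · simp [w.2.1]
  right_inv := by
    rintro ⟨x, hx⟩
    by_cases h : x = u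
    · simp [h]
    · simp [h]
  map_rel_iff' := by
    rintro (_ | a) (_ | b)
    · simp [contractEdge, mergeGraph]
    · have := b.2.1
      have := b.2.2
      simp [contractEdge, mergeGraph, huv, b.2.1, b.2.2, b.2.1.symm]
    · simp only [contractEdge, mergeGraph, SimpleGraph.comap_adj, Equiv.coe_fn_mk,
        Function.Embedding.subtype_apply, ne_eq, a.2.2, a.2.1, not_false_eq_true, huv, true_and,
        false_and, false_or, G.adj_comm a]
    · simp only [contractEdge, mergeGraph, SimpleGraph.comap_adj, Equiv.coe_fn_mk,
        Function.Embedding.subtype_apply, ne_eq, a.2.2, a.2.1, b.2.1, b.2.2, not_false_eq_true,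
        true_and, false_and, or_false]
      exact ⟨fun h => h.2, fun h => ⟨h.ne, h⟩⟩

/-- Total dominating sets of `G / uv` of size at most `k` as families of vertices of `G`. -/
theorem hasTotalDominatingSet_contractEdge_iff_family {u v : V} (huv : u ≠ v) {X : Type}
    (J : Finset X) :
    HasTotalDominatingSet (contractEdge G u v) J.card ↔
      ∃ f : X → V, ∀ y, y ≠ v → ∃ j ∈ J, (mergeGraph G u v).Adj y (f j) := by
  classical
  have : Nonempty {x | x ≠ v} := ⟨⟨u, huv⟩⟩
  rw [hasTotalDominatingSet_congr (contractEdgeIso G huv), hasTotalDominatingSet_iff_family]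
  constructor
  · rintro ⟨f, hf⟩
    exact ⟨fun x => f x, fun y hy => hf ⟨y, hy⟩⟩
  · rintro ⟨f, hf⟩
    refine ⟨fun x => if hx : f x ≠ v then ⟨f x, hx⟩ else ⟨u, huv⟩, fun y => ?_⟩
    obtain ⟨j, hj, hadj⟩ := hf y y.2
    refine ⟨j, hj, ?_⟩
    have hv : f j ≠ v := hadj.2.1
    simpa [hv] using hadj

/-! #### Graphs with an induced copy of a fixed graph -/

/-- An induced copy of `H` in an `(H + K₁)`-free graph dominates all vertices outside the copy.
The copy together with a neighbour of each of its vertices is a total dominating set. -/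
theorem hasTotalDominatingSet_of_not_isIndContained_sum [Fintype W] {H : SimpleGraph W}
    (hG : G.Connected) {u v : V} (huv : G.Adj u v) (hH : H ⊴ G)
    (hfree : ¬ (H ⊕g (⊤ : SimpleGraph (Fin 1))) ⊴ G) :
    HasTotalDominatingSet G (2 * Fintype.card W) := by
  classical
  have : Nontrivial V := ⟨u, v, huv.ne⟩
  obtain ⟨f⟩ := hH
  choose g hg using hG.preconnected.exists_adj_of_nontrivial
  refine ⟨Finset.univ.image f ∪ Finset.univ.image (g ∘ f), fun x => ?_, ?_⟩
  · by_contra! hx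
    simp only [Finset.mem_union, Finset.mem_image, Finset.mem_univ, true_and] at hx
    refine hfree ⟨⟨⟨Sum.elim f fun _ => x, ?_⟩, ?_⟩⟩
    · have hne (w : W) : f w ≠ x := fun h => hx (g x) (.inr ⟨w, by simp [h]⟩) (hg x)
      rintro (a | a) (b | b) h
      · simpa using h
      · exact absurd h (hne a)
      · exact absurd h.symm (hne b)
      · exact congrArg _ (Subsingleton.elim _ _)
    · have hna (w : W) : ¬ G.Adj x (f w) := hx (f w) (.inl ⟨w, rfl⟩)
      change ∀ {a b}, G.Adj (Sum.elim f (fun _ => x) a) (Sum.elim f (fun _ => x) b) ↔ _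
      rintro (a | a) (b | b)
      · simp [f.map_adj_iff]
      · simpa using fun h => hna a (G.adj_symm h)
      · simpa using hna b
      · simp [Subsingleton.elim a b]
  · refine (Finset.card_union_le _ _).trans ?_
    have h₁ := Finset.card_image_le (s := Finset.univ) (f := f)
    have h₂ := Finset.card_image_le (s := Finset.univ) (f := g ∘ f)
    rw [Finset.card_univ] at h₁ h₂
    omega

end

open Turing Function StackProgram

variable {X : Type} {A : TM2ComputableAux Bool Bool}

/-! ### Deciding total domination after a contraction -/

/-- The variables of the programs: `u` and `v` for the contracted edge, `z` for a number, `y` and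
`p` for loops over the vertices, `s` and `t` for looking up entries of the adjacency matrix, and
`x j` for the vertices of a dominating set or of an induced copy. -/
inductive Vr (X : Type) : Type
  | u | v | z | y | p | s | t
  | x (j : X)
  deriving DecidableEq, Fintype

/-- All variables denote vertices, and `s` and `t` are free for looking up matrix entries. -/
def Base (n : ℕ) (e : Vr X → ℕ) : Prop := (∀ i, e i < n) ∧ e .s = 0 ∧ e .t = 0

/-- Only the variables `u`, `v` and `z` are in use. -/
def Clean (n : ℕ) (e : Vr X → ℕ) : Prop := Base n e ∧ e .y = 0 ∧ e .p = 0 ∧ ∀ j, e (.x j) = 0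

variable [DecidableEq X]

theorem Base.update {n : ℕ} {e : Vr X → ℕ} (h : Base n e) {i : Vr X} (hs : i ≠ .s) (ht : i ≠ .t)
    {a : ℕ} (ha : a < n) : Base n (update e i a) := by
  refine ⟨fun j => ?_, by rw [update_of_ne hs.symm, h.2.1], by rw [update_of_ne ht.symm, h.2.2]⟩
  by_cases hj : j = i
  · subst hj; simpa using ha
  · rw [update_of_ne hj]; exact h.1 j

theorem decides_adj {i j : Vr X} (hi : i ≠ .s ∧ i ≠ .t) (hj : j ≠ .s ∧ j ≠ .t) :
    Decides A (fun n _ e _ => Base n e) fun _ G e => AdjNat G (e i) (e j) :=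
  (Decides.adj (x := .s) (y := .t) hi.1.symm hj.2.symm (by simp) hi.2.symm hj.1.symm).mono
    (fun _ _ _ _ h => ⟨h.1 i, h.1 j, h.2.1, h.2.2⟩) (by simp)

theorem decides_eq {i j : Vr X} (hij : i ≠ j) :
    Decides A (fun n _ e _ => Base n e) fun _ _ e => e i = e j :=
  (Decides.eq hij).mono (fun _ _ _ _ h => ⟨(h.1 i).le, (h.1 j).le⟩) (by simp)

theorem adjNat_coe {n : ℕ} (G : SimpleGraph (Fin n)) (a b : Fin n) :
    AdjNat G a b ↔ G.Adj a b :=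
  ⟨fun ⟨_, _, h⟩ => h, fun h => ⟨a.2, b.2, h⟩⟩

/-- Adjacency of the vertices with the numbers `c` and `d` after merging the vertex with the number
`b` into that with the number `a`. -/
def MergeNat {n : ℕ} (G : SimpleGraph (Fin n)) (a b c d : ℕ) : Prop :=
  (c ≠ b ∧ d ≠ b ∧ c ≠ d) ∧ (AdjNat G c d ∨ (c = a ∧ AdjNat G b d) ∨ (d = a ∧ AdjNat G c b))

theorem mergeNat_coe {n : ℕ} (G : SimpleGraph (Fin n)) (a b c d : Fin n) :
    MergeNat G a b c d ↔ (mergeGraph G a b).Adj c d := by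
  simp only [MergeNat, mergeGraph, adjNat_coe, ne_eq, Fin.val_inj, and_assoc]

theorem decides_merge {i j : Vr X} (hi : i ≠ .s ∧ i ≠ .t ∧ i ≠ .u ∧ i ≠ .v)
    (hj : j ≠ .s ∧ j ≠ .t ∧ j ≠ .u ∧ j ≠ .v) (hij : i ≠ j) :
    Decides A (fun n _ e _ => Base n e)
      fun _ G e => MergeNat G (e .u) (e .v) (e i) (e j) := by
  have hi' : i ≠ .s ∧ i ≠ .t := ⟨hi.1, hi.2.1⟩
  have hj' : j ≠ .s ∧ j ≠ .t := ⟨hj.1, hj.2.1⟩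
  exact (((decides_eq hi.2.2.2).not.and ((decides_eq hj.2.2.2).not.and (decides_eq hij).not)).and
    ((decides_adj hi' hj').or (((decides_eq hi.2.2.1).and (decides_adj (by simp) hj')).or
      ((decides_eq hj.2.2.1).and (decides_adj hi' (by simp)))))).mono
    (fun _ _ _ _ h => ⟨⟨h, fun _ => ⟨h, fun _ => h⟩⟩,
      fun _ => ⟨h, ⟨h, fun _ => h⟩, h, fun _ => h⟩⟩) (fun _ _ _ _ _ => Iff.rfl)

/-- Quantification over the values of the variables `x j` with `j ∈ J` is quantification over
families of vertices. -/
theorem exists_env_iff {n : ℕ} (J : Finset X) (e : Vr X → ℕ) (hn : 0 < n)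
    {Q : (X → ℕ) → Prop} (hQ : ∀ f g, (∀ j ∈ J, f j = g j) → Q f → Q g) :
    (∃ e' : Vr X → ℕ, (∀ i ∈ J.image .x, e' i < n) ∧ (∀ i ∉ J.image .x, e' i = e i) ∧
      Q fun j => e' (.x j)) ↔ ∃ f : X → Fin n, Q fun j => f j := by
  constructor
  · rintro ⟨e', he', -, h⟩
    refine ⟨fun j => if hj : e' (.x j) < n then ⟨_, hj⟩ else ⟨0, hn⟩, hQ _ _ (fun j hj => ?_) h⟩
    have := he' _ (Finset.mem_image_of_mem _ hj)
    simp [this]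
  · rintro ⟨f, h⟩
    refine ⟨fun i => match i with
      | .x j => if j ∈ J then f j else e (.x j)
      | i => e i, ?_, ?_, hQ _ _ (fun j hj => by simp [hj]) h⟩
    · intro i hi
      obtain ⟨j, hj, rfl⟩ := Finset.mem_image.1 hi
      simp [hj]
    · intro i hi
      cases i with
      | x j =>
        have : j ∉ J := fun hj => hi (Finset.mem_image_of_mem _ hj)
        simp [this]
      | _ => rfl

/-- For a fixed bound, exhaustive search for a total dominating set is polynomial. -/
theorem decides_hasTotalDominatingSet (J : Finset X) :
    Decides A (fun n _ (e : Vr X → ℕ) _ => Clean n e)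
      fun _ G _ => HasTotalDominatingSet G J.card := by
  have h := ((Decides.finExists fun j : J => decides_adj (A := A) (X := X) (i := .y) (j := .x j)
    (by simp) (by simp)).ball .y).bexSet (J.image .x)
  refine h.mono ?_ ?_
  · rintro n G e o ⟨hb, hy, -, hx⟩
    refine ⟨fun i hi => ?_, fun e' he' hs => ⟨(hs .y (by simp)).trans hy, fun a ha =>
      Base.update ⟨fun i => ?_, ?_, ?_⟩ (by simp) (by simp) ha⟩⟩
    · obtain ⟨j, -, rfl⟩ := Finset.mem_image.1 hi
      exact hx j
    · by_cases hi : i ∈ J.image .x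
      · exact he' i hi
      · rw [hs i hi]; exact hb.1 i
    · exact (hs .s (by simp)).trans hb.2.1
    · exact (hs .t (by simp)).trans hb.2.2
  · rintro n G e o ⟨hb, -⟩
    have hn : 0 < n := (Nat.zero_le _).trans_lt (hb.1 .s)
    have : Nonempty (Fin n) := ⟨⟨0, hn⟩⟩
    rw [hasTotalDominatingSet_iff_family]
    simp only [update_self, ne_eq, reduceCtorEq, not_false_eq_true, update_of_ne]
    rw [exists_env_iff J e hn (Q := fun f => ∀ a < n, ∃ j : J, AdjNat G a (f j))
      fun f g hfg h a ha => (h a ha).imp fun j hj => by rwa [← hfg j j.2]]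
    refine exists_congr fun f => ⟨fun h a ha => ?_, fun h a => ?_⟩
    · obtain ⟨j, hj, hadj⟩ := h ⟨a, ha⟩
      exact ⟨⟨j, hj⟩, (adjNat_coe G ⟨a, ha⟩ _).2 hadj⟩
    · obtain ⟨j, hadj⟩ := h a a.2
      exact ⟨j, j.2, (adjNat_coe G a _).1 hadj⟩

/-- Contracting the vertices with the numbers `a` and `b` gives a graph with a total dominating set
of size at most `k`. -/
def ContractionHas {n : ℕ} (G : SimpleGraph (Fin n)) (a b k : ℕ) : Prop :=
  ∃ (ha : a < n) (hb : b < n), HasTotalDominatingSet (contractEdge G ⟨a, ha⟩ ⟨b, hb⟩) k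

/-- The same search in the contracted graph, which is represented as `mergeGraph` on the vertices
of `G`. -/
theorem decides_contractionHas (J : Finset X) :
    Decides A (fun n G (e : Vr X → ℕ) _ => Clean n e ∧ AdjNat G (e .u) (e .v))
      fun _ G e => ContractionHas G (e .u) (e .v) J.card := by
  have h := (((decides_eq (i := .y) (j := .v) (by simp)).or (Decides.finExists fun j : J =>
    decides_merge (A := A) (X := X) (i := .y) (j := .x j)
    (by simp) (by simp) (by simp))).ball .y).bexSet (J.image .x)
  refine h.mono ?_ ?_
  · rintro n G e o ⟨⟨hb, hy, -, hx⟩, -⟩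
    have key (e' : Vr X → ℕ) (he' : ∀ i ∈ J.image .x, e' i < n)
        (hs : ∀ i ∉ J.image .x, e' i = e i) (a : ℕ) (ha : a < n) : Base n (update e' .y a) := by
      refine Base.update ⟨fun i => ?_, ?_, ?_⟩ (by simp) (by simp) ha
      · by_cases hi : i ∈ J.image .x
        · exact he' i hi
        · rw [hs i hi]; exact hb.1 i
      · exact (hs .s (by simp)).trans hb.2.1
      · exact (hs .t (by simp)).trans hb.2.2
    refine ⟨fun i hi => ?_, fun e' he' hs => ⟨(hs .y (by simp)).trans hy, fun a ha =>
      ⟨key e' he' hs a ha, key e' he' hs a ha⟩⟩⟩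
    obtain ⟨j, -, rfl⟩ := Finset.mem_image.1 hi
    exact hx j
  · rintro n G e o ⟨⟨hb, -⟩, hu, hv, huv⟩
    have hn : 0 < n := (Nat.zero_le _).trans_lt (hb.1 .s)
    have hc : ContractionHas G (e .u) (e .v) J.card ↔
        HasTotalDominatingSet (contractEdge G ⟨e .u, hu⟩ ⟨e .v, hv⟩) J.card :=
      ⟨fun ⟨_, _, h⟩ => h, fun h => ⟨hu, hv, h⟩⟩
    rw [hc, hasTotalDominatingSet_contractEdge_iff_family huv.ne]
    simp only [update_self, ne_eq, reduceCtorEq, not_false_eq_true, update_of_ne]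
    have he (e' : Vr X → ℕ) (hs : ∀ i ∉ J.image .x, e' i = e i) : e' .u = e .u ∧ e' .v = e .v :=
      ⟨hs _ (by simp), hs _ (by simp)⟩
    have hrw (e' : Vr X → ℕ) : ((∀ i ∈ J.image .x, e' i < n) ∧ (∀ i ∉ J.image .x, e' i = e i) ∧
        ∀ a < n, a = e' .v ∨ ∃ j : J, MergeNat G (e' .u) (e' .v) a (e' (.x j))) ↔
        ((∀ i ∈ J.image .x, e' i < n) ∧ (∀ i ∉ J.image .x, e' i = e i) ∧
        ∀ a < n, a = e .v ∨ ∃ j : J, MergeNat G (e .u) (e .v) a (e' (.x j))) := by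
      refine and_congr_right fun _ => and_congr_right fun hs => ?_
      rw [(he e' hs).1, (he e' hs).2]
    simp only [hrw]
    rw [exists_env_iff J e hn (Q := fun f => ∀ a < n, a = e .v ∨
        ∃ j : J, MergeNat G (e .u) (e .v) a (f j))
      fun f g hfg h a ha => (h a ha).imp_right fun ⟨j, hj⟩ => ⟨j, by rwa [← hfg j j.2]⟩]
    refine exists_congr fun f => ⟨fun h a ha => ?_, fun h a hav => ?_⟩
    · by_cases hav : a = e .v
      · exact .inl hav
      · obtain ⟨j, hj, hadj⟩ := h ⟨a, ha⟩ (by simpa [Fin.ext_iff] using hav)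
        exact .inr ⟨⟨j, hj⟩, (mergeNat_coe G ⟨e .u, hu⟩ ⟨e .v, hv⟩ ⟨a, ha⟩ _).2 hadj⟩
    · rcases h a a.2 with h | ⟨j, hadj⟩
      · exact absurd (Fin.ext h) hav
      · exact ⟨j, j.2, (mergeNat_coe G ⟨e .u, hu⟩ ⟨e .v, hv⟩ a _).1 hadj⟩

/-- The property decided in the end: some contraction gives a graph with a total dominating set of
size at most `k`, for some `k < q` that is too small for `G` itself. -/
def ReducibleBelow {n : ℕ} (G : SimpleGraph (Fin n)) (q : ℕ) : Prop :=
  ∃ a < n, ∃ b < n, AdjNat G a b ∧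
    ∃ k < q, ContractionHas G a b k ∧ ¬ HasTotalDominatingSet G k

/-- The search for `k` may stop at any upper bound of `γ_t(G)`. -/
theorem reducibleBelow_iff {n : ℕ} {G : SimpleGraph (Fin n)} (hG : G.Connected) {q : ℕ}
    (hq : ∀ u v, G.Adj u v → HasTotalDominatingSet G q) :
    HasReducingContraction G ↔ ReducibleBelow G q := by
  rw [hasReducingContraction_iff hG]
  constructor
  · rintro ⟨u, v, huv, k, hk, hk'⟩
    refine ⟨u, u.2, v, v.2, (adjNat_coe _ _ _).2 huv, k, ?_, ⟨u.2, v.2, hk⟩, hk'⟩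
    by_contra hqk
    exact hk' ((hq u v huv).mono (not_lt.1 hqk))
  · rintro ⟨a, ha, b, hb, ⟨_, _, h⟩, k, -, ⟨_, _, hk⟩, hk'⟩
    exact ⟨_, _, h, k, hk, hk'⟩

theorem clean_update {n : ℕ} {e : Vr X → ℕ} (h : Clean n e) {i : Vr X}
    (hi : i = .u ∨ i = .v ∨ i = .z) {a : ℕ} (ha : a < n) : Clean n (update e i a) := by
  obtain ⟨hb, hy, hp, hx⟩ := h
  rcases hi with rfl | rfl | rfl <;>
    exact ⟨hb.update (by simp) (by simp) ha, by simpa using hy, by simpa using hp,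
      fun j => by simpa using hx j⟩

/-- Quantification over the edges of the graph, with the bound variables `u` and `v`. -/
theorem decides_exists_edge {D : Domain (Vr X)}
    {P : ∀ n, SimpleGraph (Fin n) → (Vr X → ℕ) → Prop} (h : Decides A D P) :
    Decides A (fun n G e o => Clean n e ∧ e .u = 0 ∧ e .v = 0 ∧
        ∀ a < n, ∀ b < n, AdjNat G a b → D n G (update (update e .u a) .v b) o)
      fun n G e => ∃ a < n, ∃ b < n, AdjNat G a b ∧ P n G (update (update e .u a) .v b) := by
  refine ((((decides_adj (A := A) (X := X) (i := .u) (j := .v) (by simp) (by simp)).and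
    h).bex .v).bex .u).mono ?_ ?_
  · rintro n G e o ⟨hc, hu, hv, hD⟩
    refine ⟨hu, fun a ha => ⟨by simpa using hv, fun b hb =>
      ⟨(clean_update (clean_update hc (by simp) ha) (by simp) hb).1, fun hab => ?_⟩⟩⟩
    exact hD a ha b hb (by simpa using hab)
  · rintro n G e o -
    simp

/-- Exhaustive search decides in polynomial time whether some contraction lowers the total
domination number, as long as this number is bounded by a constant. -/
theorem decides_reducibleBelow [Fintype X] :
    Decides A (fun n _ (e : Vr X → ℕ) _ => 0 < n ∧ ∀ i, e i = 0)
      fun _ G _ => ReducibleBelow G (Fintype.card X) := by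
  have hJ (k : Fin (Fintype.card X)) : ∃ J : Finset X, J.card = k := by
    obtain ⟨J, -, hJ⟩ := Finset.exists_subset_card_eq (s := (Finset.univ : Finset X)) k.2.le
    exact ⟨J, hJ⟩
  choose J hJ using hJ
  refine (decides_exists_edge (D := fun n G e _ => Clean n e ∧ AdjNat G (e .u) (e .v))
    (P := fun n G e => ∃ k : Fin (Fintype.card X), ContractionHas G (e .u) (e .v) k ∧
      ¬ HasTotalDominatingSet G k) (Decides.finExists fun k => ?_)).mono ?_ ?_
  · rw [← hJ k]
    exact ((decides_contractionHas (J k)).and (decides_hasTotalDominatingSet (J k)).not).mono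
      (fun _ _ _ _ h => ⟨h, fun _ => h.1⟩) (by simp)
  · rintro n G e o ⟨hn, h0⟩
    have hc : Clean n e := ⟨⟨fun i => by rw [h0]; exact hn, h0 _, h0 _⟩, h0 _, h0 _, fun _ => h0 _⟩
    refine ⟨hc, h0 _, h0 _, fun a ha b hb hab =>
      ⟨clean_update (clean_update hc (by simp) ha) (by simp) hb, by simpa using hab⟩⟩
  · rintro n G e o -
    simp [ReducibleBelow, Fin.exists_iff, and_left_comm]

/-- Exhaustive search for an induced copy of a fixed graph is polynomial. -/
theorem decides_isIndContained {W : Type} [Fintype W] (H : SimpleGraph W) (ρ : W ↪ X) :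
    Decides A (fun n _ (e : Vr X → ℕ) _ => 0 < n ∧ ∀ i, e i = 0) fun _ G _ => H ⊴ G := by
  classical
  have hpair (w : W × W) : Decides A (fun n _ (e : Vr X → ℕ) _ => Base n e)
      fun _ G e => w.1 ≠ w.2 → e (.x (ρ w.1)) ≠ e (.x (ρ w.2)) ∧
        (AdjNat G (e (.x (ρ w.1))) (e (.x (ρ w.2))) ↔ H.Adj w.1 w.2) := by
    by_cases hw : w.1 = w.2
    · exact (Decides.const True).mono (by simp) (by simp [hw])
    · have h₁ := (decides_eq (A := A) (i := Vr.x (ρ w.1)) (j := .x (ρ w.2)) (by simpa using hw)).not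
      have h₂ := decides_adj (A := A) (i := Vr.x (ρ w.1)) (j := .x (ρ w.2)) (by simp) (by simp)
      by_cases hH : H.Adj w.1 w.2
      · exact (h₁.and h₂).mono (fun _ _ _ _ h => ⟨h, fun _ => h⟩) (by simp [hw, hH])
      · exact (h₁.and h₂.not).mono (fun _ _ _ _ h => ⟨h, fun _ => h⟩) (by simp [hw, hH])
  let J : Finset X := Finset.univ.map ρ
  refine ((Decides.finForall hpair).bexSet (J.image .x)).mono ?_ ?_
  · rintro n G e o ⟨hn, h0⟩
    refine ⟨fun i _ => h0 i, fun e' he' hs => ⟨fun i => ?_, ?_, ?_⟩⟩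
    · by_cases hi : i ∈ J.image .x
      · exact he' i hi
      · rw [hs i hi, h0]; exact hn
    · exact (hs .s (by simp)).trans (h0 _)
    · exact (hs .t (by simp)).trans (h0 _)
  · rintro n G e o ⟨hn, -⟩
    rw [exists_env_iff J e hn (Q := fun f => ∀ w : W × W, w.1 ≠ w.2 → f (ρ w.1) ≠ f (ρ w.2) ∧
      (AdjNat G (f (ρ w.1)) (f (ρ w.2)) ↔ H.Adj w.1 w.2))]
    · constructor
      · rintro ⟨φ⟩
        refine ⟨extend ρ φ fun _ => ⟨0, hn⟩, fun w hw => ?_⟩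
        simp only [ρ.injective.extend_apply, adjNat_coe]
        exact ⟨fun h => hw (φ.injective (Fin.ext h)), φ.map_adj_iff⟩
      · rintro ⟨f, hf⟩
        refine ⟨⟨⟨fun w => f (ρ w), fun w w' h => ?_⟩, fun {w w'} => ?_⟩⟩
        · by_contra hw
          exact (hf (w, w') hw).1 (congrArg _ h)
        · by_cases hw : w = w'
          · subst hw; simp
          · have := (hf (w, w') hw).2
            rwa [adjNat_coe] at this
    · intro f g hfg h w hw
      have hg (w : W) : f (ρ w) = g (ρ w) := hfg _ (by simp [J])
      rw [← hg, ← hg]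
      exact h w hw

/-! ### The oracle input for a graph and for a contracted graph -/

open Classical in
/-- The code of the graph on the positions of the list `L` whose adjacency is the relation `R` on
the entries. -/
noncomputable def listCode (L : List ℕ) (R : ℕ → ℕ → Prop) : List Bool :=
  encodeUnary L.length ++ L.flatMap fun a => L.map fun b => decide (R a b)

theorem encodeGraph_eq_listCode {n : ℕ} (G : SimpleGraph (Fin n)) :
    encodeGraph ⟨n, G⟩ = listCode (List.range n) (AdjNat G) := by
  rw [encodeGraph_eq, listCode, encodeUnary, List.length_range, List.append_assoc]
  simp only [matrixBits, matrixBefore, List.range_zero, List.map_nil, List.append_nil,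
    List.singleton_append]
  rfl

theorem listCode_eq_encodeGraph {L : List ℕ} {R : ℕ → ℕ → Prop} {G : SimpleGraph (Fin L.length)}
    (h : ∀ i j, G.Adj i j ↔ R L[i] L[j]) : listCode L R = encodeGraph ⟨L.length, G⟩ := by
  classical
  have hL (f : ℕ → List Bool) :
      L.flatMap f = (List.ofFn fun i : Fin L.length => f L[i]).flatten := by
    rw [List.flatMap]
    congr 1
    exact (List.ofFn_getElem_eq_map L f).symm
  rw [listCode, encodeGraph, hL]
  congr 3
  funext i
  rw [← List.ofFn_getElem_eq_map]
  congr 1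
  funext j
  rw [decide_eq_decide]
  exact (h i j).symm

theorem length_listCode (L : List ℕ) (R : ℕ → ℕ → Prop) :
    (listCode L R).length = L.length + 1 + L.length * L.length := by
  simp [listCode, encodeUnary]
  ring

/-- A loop whose body emits words only for the indices with `Q` is a loop over these indices. -/
theorem flatMap_guard {β : Type} (l : List ℕ) (Q : ℕ → Prop) [DecidablePred Q]
    (f : ℕ → List β) :
    (l.flatMap fun a => if Q a then f a else []) = (l.filter (Q ·)).flatMap f := by
  induction l with
  | nil => rfl
  | cons a l ih => by_cases h : Q a <;> simp [h, ih]

open Classical in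
/-- The code of a graph on some of the vertices can be prepared as oracle input, if its vertices and
its adjacency can be decided. Both may depend on the values of `u` and `v`. -/
theorem emits_listCode {Q : ∀ n, SimpleGraph (Fin n) → ℕ → ℕ → ℕ → Prop}
    {R : ∀ n, SimpleGraph (Fin n) → ℕ → ℕ → ℕ → ℕ → Prop}
    (hQ : ∀ i : Vr X, i = .y ∨ i = .p → Decides A (fun n _ e _ => Base n e)
      fun n G e => Q n G (e .u) (e .v) (e i))
    (hR : Decides A (fun n _ (e : Vr X → ℕ) _ => Base n e)
      fun n G e => R n G (e .u) (e .v) (e .y) (e .p)) :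
    Emits A (fun n _ (e : Vr X → ℕ) => Clean n e) fun n G e =>
      listCode ((List.range n).filter (Q n G (e .u) (e .v))) (R n G (e .u) (e .v)) := by
  have hrow := Emits.guard (D := fun n _ e => Base n e) (hQ .p (.inr rfl))
    (Emits.truthValue (D := fun n _ e => Base n e) hR)
  have hmat := (Emits.guard (D := fun n _ e => Base n e) (hQ .y (.inl rfl)) (hrow.loop .p)).loop .y
  have hnum := (Emits.guard (D := fun n _ e => Base n e) (hQ .y (.inl rfl))
    (Emits.bit true)).loop .y
  refine ((hnum.append (Emits.bit false)).append hmat).mono ?_ ?_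
  · rintro n G e ⟨hb, hy, hp, -⟩
    refine ⟨⟨⟨hy, fun a ha => ⟨hb.update (by simp) (by simp) ha, fun _ => trivial⟩⟩, trivial⟩,
      hy, fun a ha => ⟨hb.update (by simp) (by simp) ha, fun _ => ⟨by simpa using hp,
      fun b hb' => ?_⟩⟩⟩
    have := (hb.update (i := .y) (by simp) (by simp) ha).update (i := .p) (by simp) (by simp) hb'
    exact ⟨this, fun _ => this⟩
  · rintro n G e -
    simp only [update_self, ne_eq, reduceCtorEq, not_false_eq_true, update_of_ne, flatMap_guard,
      listCode, encodeUnary]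
    congr 2
    · rw [← List.map_eq_flatMap]; simp
    · funext a
      rw [← List.map_eq_flatMap]

theorem emits_graph : Emits A (fun n _ (e : Vr X → ℕ) => Clean n e) fun n G _ =>
    encodeGraph ⟨n, G⟩ := by
  refine (emits_listCode (Q := fun _ _ _ _ _ => True) (R := fun _ G _ _ a b => AdjNat G a b)
    (fun _ _ => (Decides.const True).mono (by simp) (by simp))
    (decides_adj (by simp) (by simp))).mono (fun _ _ _ h => h) fun n G e _ => ?_
  rw [encodeGraph_eq_listCode]
  simp

/-- The numbers of the vertices that are left if the vertex with the number `b` is deleted. -/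
def verticesWithout (n b : ℕ) : List ℕ := (List.range n).filter (· ≠ b)

theorem mem_verticesWithout {n b a : ℕ} : a ∈ verticesWithout n b ↔ a < n ∧ a ≠ b := by
  simp [verticesWithout]

/-- The graph `G / ab` on the positions of the list of vertices other than `b`. -/
theorem exists_contractEdge_iso {n : ℕ} (G : SimpleGraph (Fin n)) {a b : Fin n} (hab : a ≠ b) :
    ∃ G' : SimpleGraph (Fin (verticesWithout n b).length), Nonempty (contractEdge G a b ≃g G') ∧
      listCode (verticesWithout n b) (MergeNat G a b) = encodeGraph ⟨_, G'⟩ := by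
  have hlt (i : Fin (verticesWithout n b).length) :
      (verticesWithout n b)[i] < n ∧ (verticesWithout n b)[i] ≠ b :=
    mem_verticesWithout.1 (List.getElem_mem _)
  let φ (i : Fin (verticesWithout n b).length) : {x : Fin n | x ≠ b} :=
    ⟨⟨_, (hlt i).1⟩, fun h => (hlt i).2 (congrArg Fin.val h)⟩
  have hφ : Bijective φ := by
    constructor
    · intro i j hij
      have hij : (verticesWithout n b)[i] = (verticesWithout n b)[j] :=
        congrArg (fun x : {x : Fin n | x ≠ b} => (x : Fin n).val) hij
      exact Fin.ext ((List.Nodup.getElem_inj_iff (List.nodup_range.filter _)).1 hij)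
    · rintro ⟨x, hx⟩
      obtain ⟨i, hi, hix⟩ := List.getElem_of_mem (mem_verticesWithout.2
        ⟨x.2, fun h => hx (Fin.ext h)⟩ : (x : ℕ) ∈ verticesWithout n b)
      exact ⟨⟨i, hi⟩, Subtype.ext (Fin.ext hix)⟩
  let e := Equiv.ofBijective φ hφ
  refine ⟨((mergeGraph G a b).induce {x | x ≠ b}).comap φ,
    ⟨(contractEdgeIso G hab).trans (SimpleGraph.Iso.comap e _).symm⟩,
    listCode_eq_encodeGraph fun i j => ?_⟩
  exact (mergeNat_coe G a b ⟨_, (hlt i).1⟩ ⟨_, (hlt j).1⟩).symm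

/-- The code of `G / uv` can be prepared as oracle input; by `exists_contractEdge_iso` the word is
the code of a graph isomorphic to `G / uv`. -/
theorem emits_contraction : Emits A (fun n _ (e : Vr X → ℕ) => Clean n e) fun n G e =>
    listCode (verticesWithout n (e .v)) (MergeNat G (e .u) (e .v)) := by
  classical
  refine (emits_listCode (Q := fun _ _ _ b a => a ≠ b)
    (R := fun _ G a b c d => MergeNat G a b c d) (fun i hi => ?_)
    (decides_merge (by simp) (by simp) (by simp))).mono (fun _ _ _ h => h) fun n G e _ => ?_
  · exact (decides_eq (by rcases hi with rfl | rfl <;> simp)).not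
  · simp [verticesWithout]

/-- The value of the variable `z` can be prepared in unary as oracle input. -/
theorem emits_unary : Emits A (fun n _ (e : Vr X → ℕ) => Clean n e) fun _ _ e =>
    encodeUnary (e .z) := by
  classical
  have hlt : Decides A (fun n _ (e : Vr X → ℕ) _ => Base n e) fun _ _ e => e .p < e .z :=
    (Decides.lt (i := .p) (j := .z) (by simp)).mono
      (fun _ _ _ _ h => ⟨(h.1 _).le, (h.1 _).le⟩) (by simp)
  refine (((Emits.guard (D := fun n _ e => Base n e) hlt
    (Emits.bit true)).loop .p).append (Emits.bit false)).mono ?_ ?_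
  · rintro n G e ⟨hb, -, hp, -⟩
    exact ⟨⟨hp, fun a ha => ⟨hb.update (by simp) (by simp) ha, fun _ => trivial⟩⟩, trivial⟩
  · rintro n G e ⟨hb, -⟩
    obtain ⟨c, hc⟩ := Nat.exists_eq_add_of_le (hb.1 .z).le
    have h₁ : (List.range n).filter (· < e .z) = List.range (e .z) := by
      rw [hc, List.range_add, List.filter_append, List.filter_eq_self.2 (by simp),
        List.filter_eq_nil_iff.2 (by simp), List.append_nil]
    simp only [update_self, ne_eq, reduceCtorEq, not_false_eq_true, update_of_ne, flatMap_guard,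
      encodeUnary, h₁]
    rw [← List.map_eq_flatMap]
    simp

/-! ### Calling the given algorithms -/

/-- An algorithm for a problem, in the form in which it is used as an oracle. -/
theorem exists_oracle {α : Type} {enc : α → List Bool} {P : α → Prop}
    (h : PolyTimeDecidable enc P) : ∃ (A : TM2ComputableAux Bool Bool) (p : Polynomial ℕ),
      ∀ a (q : Polynomial ℕ) n, (enc a).length ≤ q.eval n → ∃ c : Bool,
        Nonempty (TM2OutputsInTime A.tm ((enc a).map A.inputAlphabet.invFun)
          (some ([c].map A.outputAlphabet.invFun)) ((p.comp q).eval n)) ∧ (c = true ↔ P a) := by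
  classical
  obtain ⟨M⟩ := h
  refine ⟨M.toTM2ComputableAux, M.time, fun a q n hm => ⟨decide (P a), ⟨?_⟩, by simp⟩⟩
  exact ⟨(M.outputsFun a).toEvalsTo, (M.outputsFun a).steps_le_m.trans
    (by rw [Polynomial.eval_comp]; exact eval_mono _ hm)⟩

/-! ### The three cases -/

/-- If `γ_t` is bounded by the size of `X` wherever it is finite, exhaustive search through families
of vertices indexed by subsets of `X` is polynomial. -/
theorem edgeContractionPolyTimeOn_of_bounded {X : Type} [Fintype X] (C : GraphClass)
    (h : ∀ {V : Type} (G : SimpleGraph V), C.Mem G → totalDominationNumber G ≠ ⊤ →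
      totalDominationNumber G ≤ Fintype.card X) : EdgeContractionPolyTimeOn C := by
  classical
  -- no oracle is called, so any machine serves as `A`
  let A : TM2ComputableAux Bool Bool := ⟨idComputer Bool, Equiv.refl _, Equiv.refl _⟩
  refine (decides_reducibleBelow (A := A) (X := X)).polyTimeDecidable ?_ ?_
  · intro n G hG
    have := (C.connected hG).nonempty
    exact ⟨Fin.pos_iff_nonempty.2 this, fun _ => rfl⟩
  · rintro ⟨⟨n, G⟩, hG⟩
    refine reducibleBelow_iff (C.connected hG) fun u v huv => ?_
    rw [← totalDominationNumber_le_iff]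
    refine h G hG ?_
    have := hasTotalDominatingSet_card (C.connected hG) huv
    rw [← totalDominationNumber_le_iff] at this
    exact (this.trans_lt (ENat.natCast_lt_top _)).ne

/-- The program tests for an induced copy of `H`. If there is one, `γ_t` is at most `2 |V(H)|`, the
size of `W ⊕ W`, and the program searches exhaustively; if there is none, it calls the algorithm for
`H`-free graphs, which is not called otherwise. -/
theorem edgeContractionPolyTimeOn_freeClass_sum {W : Type} [Fintype W] (H : SimpleGraph W)
    (h : EdgeContractionPolyTimeOn (freeClass H)) :
    EdgeContractionPolyTimeOn (freeClass (H ⊕g (⊤ : SimpleGraph (Fin 1)))) := by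
  classical
  obtain ⟨A, p, hA⟩ := exists_oracle h
  have h₁ := (decides_isIndContained (A := A) (X := W ⊕ W) H ⟨Sum.inl, Sum.inl_injective⟩).ite
    (decides_reducibleBelow (A := A) (X := W ⊕ W))
    (Decides.oracle (P := fun _ G _ => HasReducingContraction G) emits_graph
      (p.comp (Polynomial.X + 1 + Polynomial.X * Polynomial.X)))
  refine h₁.polyTimeDecidable ?_ ?_
  · rintro n G ⟨hfin, hcon, -⟩
    have hn : 0 < n := Fin.pos_iff_nonempty.2 hcon.nonempty
    refine ⟨⟨hn, fun _ => rfl⟩, fun _ => ⟨hn, fun _ => rfl⟩, fun hH => ⟨?_, rfl, ?_⟩⟩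
    · exact ⟨⟨fun _ => hn, rfl, rfl⟩, rfl, rfl, fun _ => rfl⟩
    · refine hA ⟨⟨n, G⟩, hfin, hcon, hH⟩ _ n ?_
      simp [encodeGraph_eq_listCode, length_listCode]
  · rintro ⟨⟨n, G⟩, hfin, hcon, hfree⟩
    by_cases hH : H ⊴ G
    · have := reducibleBelow_iff (q := Fintype.card (W ⊕ W)) hcon fun u v huv => by
        have := hasTotalDominatingSet_of_not_isIndContained_sum hcon huv hH hfree
        rwa [two_mul, ← Fintype.card_sum] at this
      simp [hH, this]
    · simp [hH]

/-- The program runs through the edges `uv` and the numbers `k` below the number of vertices, and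
calls the algorithm for Total Dominating Set on `G / uv` and on `G`. Closure under contraction is
what entitles it to the first call. -/
theorem edgeContractionPolyTimeOn_of_totalDominatingSet (C : GraphClass)
    (hC : C.ClosedUnderEdgeContraction) (h : TotalDominatingSetPolyTimeOn C) :
    EdgeContractionPolyTimeOn C := by
  classical
  obtain ⟨A, p, hA⟩ := exists_oracle h
  -- a bound on the length of the oracle inputs
  let q : Polynomial ℕ := Polynomial.X + 1 + (Polynomial.X + 1 + Polynomial.X * Polynomial.X)
  have h₁ := Decides.oracle (A := A)
    (P := fun _ G (e : Vr Empty → ℕ) => ContractionHas G (e .u) (e .v) (e .z))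
    (emits_unary.append emits_contraction) (p.comp q)
  have h₂ := Decides.oracle (A := A)
    (P := fun _ G (e : Vr Empty → ℕ) => HasTotalDominatingSet G (e .z))
    (emits_unary.append emits_graph) (p.comp q)
  refine ((decides_exists_edge ((h₁.and h₂.not).bex .z)).mono
    (D' := fun n G e o => C.Mem G ∧ (∀ i, e i = 0) ∧ o = [])
    (P' := fun n G _ => ReducibleBelow G n) ?_ ?_).polyTimeDecidable
    (fun _ _ hG => ⟨hG, fun _ => rfl, rfl⟩) ?_
  · rintro n G e _ ⟨hG, h0, rfl⟩
    have hn : 0 < n := Fin.pos_iff_nonempty.2 (C.connected hG).nonempty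
    have hc : Clean n e := ⟨⟨fun i => by rw [h0]; exact hn, h0 _, h0 _⟩, h0 _, h0 _, fun _ => h0 _⟩
    refine ⟨hc, h0 _, h0 _, fun a ha b hb hab => ⟨by simp [h0], fun k hk => ?_⟩⟩
    have hc' := clean_update (clean_update (clean_update hc (i := .u) (by simp) ha)
      (i := .v) (by simp) hb) (i := .z) (by simp) hk
    refine ⟨⟨⟨hc', hc'⟩, rfl, ?_⟩, fun _ => ⟨⟨hc', hc'⟩, rfl, ?_⟩⟩
    · obtain ⟨ha', hb', hadj⟩ := hab
      obtain ⟨G', ⟨φ⟩, hG'⟩ := exists_contractEdge_iso G hadj.ne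
      have hmem : C.Mem G' := C.iso φ (hC G hG _ _ hadj)
      have hlen : (verticesWithout n b).length ≤ n :=
        (List.length_filter_le _ _).trans (by simp)
      have hA' := hA (⟨⟨_, G'⟩, hmem⟩, k) q n (by
          rw [← hG']
          simp only [q, encodeUnary, List.length_append, List.length_replicate,
            List.length_singleton, length_listCode, Polynomial.eval_add, Polynomial.eval_X,
            Polynomial.eval_one, Polynomial.eval_mul]
          gcongr)
      simp only [← hG'] at hA'
      refine (hA'.imp fun c hc => ⟨by simpa using hc.1, hc.2.trans ?_⟩)
      simp only [update_self, ne_eq, reduceCtorEq, not_false_eq_true, update_of_ne]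
      exact (hasTotalDominatingSet_congr φ).symm.trans
        ⟨fun h => ⟨ha', hb', h⟩, fun ⟨_, _, h⟩ => h⟩
    · refine (hA (⟨⟨n, G⟩, hG⟩, k) q n ?_).imp
        fun c hc => ⟨by simpa using hc.1, hc.2.trans (by simp [HasTotalDominatingSet])⟩
      simp only [q, encodeUnary, List.length_append, List.length_replicate, List.length_singleton,
        encodeGraph_eq_listCode, length_listCode, List.length_range, Polynomial.eval_add,
        Polynomial.eval_X, Polynomial.eval_one, Polynomial.eval_mul]
      gcongr
  · rintro n G e _ -
    simp [ReducibleBelow]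
  · rintro ⟨⟨n, G⟩, hG⟩
    refine reducibleBelow_iff (C.connected hG) fun u v huv => ?_
    simpa using hasTotalDominatingSet_card (C.connected hG) huv

end TotalDomination

open TotalDomination in
theorem mainTheorem9 (C : GraphClass)
    (hC : (C.ClosedUnderEdgeContraction ∧ TotalDominatingSetPolyTimeOn C) ∨
      (∃ q : ℕ, ∀ {V : Type} (G : SimpleGraph V), C.Mem G →
        totalDominationNumber G ≠ ⊤ → totalDominationNumber G ≤ q) ∨
      (∃ (W : Type) (_ : Finite W) (H : SimpleGraph W),
        C = freeClass (H ⊕g (⊤ : SimpleGraph (Fin 1))) ∧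
          EdgeContractionPolyTimeOn (freeClass H))) :
    EdgeContractionPolyTimeOn C := by
  rcases hC with ⟨hC, h⟩ | ⟨q, h⟩ | ⟨W, _, H, rfl, h⟩
  · exact edgeContractionPolyTimeOn_of_totalDominatingSet C hC h
  · exact edgeContractionPolyTimeOn_of_bounded (X := Fin q) C fun G hG ht => by
      simpa using h G hG ht
  · have := Fintype.ofFinite W
    exact edgeContractionPolyTimeOn_freeClass_sum H h
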